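/- Let $0<d<\pi/2$, let $\mathscr{D}_d=\{\zeta\in\mathbb{C}:|\operatorname{Im}\zeta|<d\}$, and let $\psi(\zeta)=\exp\!\left(\frac{\pi}{2}\sinh\zeta\right)$, so that $\psi$ maps $\mathbb{R}$ bijectively onto $(0,\infty)$, with inverse $\psi^{-1}(\tau)=\operatorname{arcsinh}\!\left(\frac{2}{\pi}\log\tau\right)$. Assume that $f$ is analytic in the image $\psi(\mathscr{D}_d)\subset\mathbb{C}$ and that $K,\alpha,\beta>0$ are constants such that $$|f(z)|\le K\left|\frac{z^{\alpha-1}}{(1+z^2)^{(\alpha+\beta)/2}}\right|\qquad\text{for all } z\in\psi(\mathscr{D}_d).$$ Let $\mu=\min\{\alpha,\beta\}$, $\nu=\max\{\alpha,\beta\}$, let $n$ be a nonnegative integer, let $h=\log(4dn/\mu)/n$, and let $$\begin{cases} M=n,\quad N=n-\lfloor\log(\beta/\alpha)/h\rfloor & (\text{if }\mu=\alpha),\\ N=n,\quad M=n-\lfloor\log(\alpha/\beta)/h\rfloor & (\text{if }\mu=\beta).\end{cases}$$ For $\gamma>0$ put $$x_\gamma=\begin{cases}\operatorname{arcsinh}\!\left(\dfrac{\sqrt{1+\sqrt{1-(2\pi\gamma)^2}}}{2\pi\gamma}\right)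 & (0<\gamma<1/(2\pi)),\\[2mm] \operatorname{arcsinh}(1) & (\gamma\ge 1/(2\pi)),\end{cases}$$ and assume that $n$ is so large that $n\ge \nu\mathrm{e}/(4d)$, $Mh\ge x_{\alpha/2}$ and $Nh\ge x_{\beta/2}$. Let $$J(k,h)(x)=h\left\{\frac12+\frac1\pi\operatorname{Si}\!\left[\pi\left(\frac{x}{h}-k\right)\right]\right\},\qquad \operatorname{Si}(x)=\int_0^x\frac{\sin\sigma}{\sigma}\,d\sigma .$$ Then $f$ is integrable on $(0,\tau)$ for every $\tau>0$, and $$\sup_{\tau\in(0,\infty)}\left|\int_0^\tau f(t)\,dt-\sum_{k=-M}^{N}f(\psi(kh))\,\psi'(kh)\,J(k,h)(\psi^{-1}(\tau))\right|\le C_2\,\varepsilon^{\mathrm{DE}}_{d,\mu}(n),$$ where $$\varepsilon^{\mathrm{DE}}_{d,\mu}(n)=\mathrm{e}^{-\pi dn/\log(4dn/\mu)}\,\frac{\log(4dn/\mu)}{n}$$ and $$C_2=\frac{2K}{\mu d}\left\{\frac{1}{(1-\mathrm{e}^{-\pi\mu\mathrm{e}/2})\{\cos(\frac{\pi}{2}\sin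 d)\}^{(\alpha+\beta)/2}\cos d}+\mathrm{e}^{\pi(\alpha+\beta)/4}\right\},$$ which does not depend on $n$. -/

import Mathlib

namespace SincDE

/-- The strip `{ζ : |Im ζ| < d}`. -/
def strip (d : ℝ) : Set ℂ := {ζ : ℂ | |ζ.im| < d}

/-- The double-exponential map `ψ(ζ) = exp((π/2) sinh ζ)`. -/
noncomputable def deMap (ζ : ℂ) : ℂ :=
  Complex.exp ((Real.pi : ℂ) / 2 * Complex.sinh ζ)

/-- The inverse `(0, ∞) → ℝ` of the restriction of `deMap` to the real line. -/
noncomputable def deInv (τ : ℝ) : ℝ := Real.arsinh (2 / Real.pi * Real.log τ)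

theorem deMap_deInv {τ : ℝ} (hτ : 0 < τ) : deMap (deInv τ : ℂ) = (τ : ℂ) := by
  have h : Real.pi / 2 * (2 / Real.pi * Real.log τ) = Real.log τ := by
    field_simp
  have : deMap (deInv τ : ℂ) = ((Real.exp (Real.pi / 2 * Real.sinh (deInv τ)) : ℝ) : ℂ) := by
    simp [deMap]
  rw [this, deInv, Real.sinh_arsinh, h, Real.exp_log hτ]

theorem deInv_deMap (x : ℝ) : deInv (deMap (x : ℂ)).re = x := by
  have : deMap (x : ℂ) = ((Real.exp (Real.pi / 2 * Real.sinh x) : ℝ) : ℂ) := by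
    simp [deMap]
  have h : 2 / Real.pi * (Real.pi / 2 * Real.sinh x) = Real.sinh x := by
    field_simp
  rw [this, Complex.ofReal_re, deInv, Real.log_exp, h, Real.arsinh_sinh]

/-- `E₂(z; α, β) = z^(α-1) / (1+z²)^((α+β)/2)` (only its modulus is used, which does not depend
on the branch of the powers, the exponents being real). -/
noncomputable def E₂ (z : ℂ) (α β : ℝ) : ℂ :=
  z ^ ((α - 1 : ℝ) : ℂ) / (1 + z ^ 2) ^ (((α + β) / 2 : ℝ) : ℂ)

/-- The sine integral `Si(x) = ∫₀ˣ sin σ / σ dσ`. -/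
noncomputable def Si (x : ℝ) : ℝ := ∫ σ in (0 : ℝ)..x, Real.sinc σ

/-- The basis function of the Sinc indefinite integration,
`J(k,h)(x) = h {1/2 + (1/π) Si[π(x/h - k)]}`. -/
noncomputable def J (k : ℤ) (h x : ℝ) : ℝ :=
  h * (1 / 2 + 1 / Real.pi * Si (Real.pi * (x / h - k)))

/-- The threshold `x_γ`, for `γ > 0`. -/
noncomputable def xThreshold (γ : ℝ) : ℝ :=
  if γ < 1 / (2 * Real.pi) then
    Real.arsinh (Real.sqrt (1 + Real.sqrt (1 - (2 * Real.pi * γ) ^ 2)) / (2 * Real.pi * γ))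
  else Real.arsinh 1

/-- The lower truncation number: `n` if `α ≤ β`, and `n - ⌊log(α/β)/h⌋` otherwise. -/
noncomputable def truncM (α β h : ℝ) (n : ℕ) : ℤ :=
  if α ≤ β then n else n - ⌊Real.log (α / β) / h⌋

/-- The upper truncation number: `n - ⌊log(β/α)/h⌋` if `α ≤ β`, and `n` otherwise. -/
noncomputable def truncN (α β h : ℝ) (n : ℕ) : ℤ :=
  if α ≤ β then n - ⌊Real.log (β / α) / h⌋ else n

/-- `ε_{d,μ}(n) = exp(-π d n / log(4 d n / μ)) · log(4 d n / μ) / n`. -/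
noncomputable def epsDE (d μ : ℝ) (n : ℕ) : ℝ :=
  Real.exp (-(Real.pi * d * n / Real.log (4 * d * n / μ))) * Real.log (4 * d * n / μ) / n

/-- The explicit constant of the error bound. -/
noncomputable def constC₂ (K α β d μ : ℝ) : ℝ :=
  2 * K / (μ * d) *
    (1 / ((1 - Real.exp (-(Real.pi * μ * Real.exp 1 / 2))) *
          Real.cos (Real.pi / 2 * Real.sin d) ^ ((α + β) / 2) * Real.cos d)
      + Real.exp (Real.pi * (α + β) / 4))

end SincDE

namespace SincDE

open MeasureTheory Filter Topology

/-! The substitution `t = ψ(s)` turns the integral into that of `F = (f ∘ ψ) ψ'` over `(-∞,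
ψ⁻¹(τ))`. The error is split through the full series over `k : ℤ` into a discretization error and a
truncation error.

Discretization. The Sinc interpolation error of `F` at `s` is a contour integral of `F(z) /
sin(πz/h)` against `sin(πs/h) / (z - s)`. Integrating in `s` over `[A, X]` before estimating gives a
kernel at most `h / |Im z|`, independently of the interval (`norm_integral_sin_div_le`). The contour
then expands to the boundary of a strip, where `|sin(πz/h)| ≥ sinh(πd/h)`, and what remains is the
`L¹` norm of `F` on horizontal lines. That norm rests on `|1 + ψ(ζ)²| ≥ (1 + e^u) cos((π/2) sin Im
ζ)` with `u = π sinh(Re ζ) cos(Im ζ)` (`one_add_exp_mul_cos_le`), which makes `F` decay like `cosh x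
· exp(-q |sinh x|)`, a function with an explicit antiderivative on each half-line.

Truncation. Since `|J| ≤ 3h/2`, each tail is a Riemann sum of `cosh x · exp(-q sinh x)`, compared
with its integral. The choice of `M`, `N` makes both tails of order `exp(-πdn)`. This is smaller
than `exp(-πdn / L)`, where `L = log(4dn/μ)`, by enough to absorb the missing factor `L / n` and the
crude constant 3 (`three_mul_exp_neg_le`). -/

/-! ### The sine integral and the basis functions `J` -/

theorem intervalIntegral_swap_of_continuousOn {E : Type*} [NormedAddCommGroup E] [NormedSpace ℝ E]
    {f : ℝ → ℝ → E} {a b c d : ℝ}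
    (hf : ContinuousOn (Function.uncurry f) (Set.uIcc a b ×ˢ Set.uIcc c d)) :
    ∫ x in a..b, ∫ y in c..d, f x y = ∫ y in c..d, ∫ x in a..b, f x y := by
  apply intervalIntegral_intervalIntegral_swap
  have : IntegrableOn (Function.uncurry f) (Set.uIcc a b ×ˢ Set.uIcc c d) :=
    hf.integrableOn_compact (isCompact_uIcc.prod isCompact_uIcc)
  exact this.mono_set (Set.prod_mono Set.uIoc_subset_uIcc Set.uIoc_subset_uIcc)

theorem integral_sin_mul_exp_left (x T : ℝ) :
    ∫ t in (0 : ℝ)..T, Real.sin x * Real.exp (-(x * t)) = Real.sinc x * (1 - Real.exp (-(x * T))) := by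
  rcases eq_or_ne x 0 with rfl | hx
  · simp
  · have hd : ∀ t ∈ Set.uIcc 0 T, HasDerivAt (fun t => -(Real.sinc x * Real.exp (-(x * t))))
        (Real.sin x * Real.exp (-(x * t))) t := by
      intro t _
      have h1 : HasDerivAt (fun t : ℝ => -(x * t)) (-x) t := by
        convert! ((hasDerivAt_id t).const_mul x).neg using 1; simp
      convert! (h1.exp.const_mul (Real.sinc x)).neg using 1
      rw [Real.sinc_of_ne_zero hx]
      field_simp
    rw [intervalIntegral.integral_eq_sub_of_hasDerivAt hd
      (by apply Continuous.intervalIntegrable; fun_prop)]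
    simp
    ring

theorem integral_sin_mul_exp_right (t R : ℝ) :
    ∫ x in (0 : ℝ)..R, Real.sin x * Real.exp (-(x * t)) =
      (1 + t ^ 2)⁻¹ - Real.exp (-(R * t)) * (Real.cos R + t * Real.sin R) / (1 + t ^ 2) := by
  have hpos : (1 + t ^ 2) ≠ 0 := by positivity
  have hd : ∀ x ∈ Set.uIcc 0 R, HasDerivAt
      (fun x => -(Real.exp (-(x * t)) * (Real.cos x + t * Real.sin x)) / (1 + t ^ 2))
      (Real.sin x * Real.exp (-(x * t))) x := by
    intro x _
    have h1 : HasDerivAt (fun x : ℝ => -(x * t)) (-t) x := by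
      convert! ((hasDerivAt_id x).mul_const t).neg using 1; simp
    convert! (h1.exp.mul ((Real.hasDerivAt_cos x).add
      ((Real.hasDerivAt_sin x).const_mul t))).neg.div_const (1 + t ^ 2) using 1
    field_simp
    simp
    ring
  rw [intervalIntegral.integral_eq_sub_of_hasDerivAt hd
      (by apply Continuous.intervalIntegrable; fun_prop)]
  simp
  field_simp
  ring

theorem integral_exp_neg_mul_le {R T : ℝ} (hR : 0 < R) :
    ∫ t in (0 : ℝ)..T, Real.exp (-(R * t)) ≤ 1 / R := by
  have hd : ∀ t ∈ Set.uIcc 0 T, HasDerivAt (fun t => -(Real.exp (-(R * t)) / R))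
      (Real.exp (-(R * t))) t := by
    intro t _
    have h1 : HasDerivAt (fun t : ℝ => -(R * t)) (-R) t := by
      convert! ((hasDerivAt_id t).const_mul R).neg using 1; simp
    convert! (h1.exp.div_const R).neg using 1
    field_simp
  rw [intervalIntegral.integral_eq_sub_of_hasDerivAt hd
      (by apply Continuous.intervalIntegrable; fun_prop)]
  have := Real.exp_pos (-(R * T))
  simp
  positivity

/-- Integrate `sin x · e^{-xt}` over `[0, R] × [0, T]` in both orders. One order gives `Si R` up to
`∫ e^{-xT} dx ≤ 1/T`, the other gives `arctan T` up to `∫ e^{-Rt} dt ≤ 1/R`. -/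
theorem abs_Si_sub_arctan_le {R T : ℝ} (hR : 0 < R) (hT : 0 < T) :
    |Si R - Real.arctan T| ≤ 1 / T + 1 / R := by
  have hsw : ∫ x in (0 : ℝ)..R, Real.sinc x * (1 - Real.exp (-(x * T))) =
      ∫ t in (0 : ℝ)..T, ((1 + t ^ 2)⁻¹ -
        Real.exp (-(R * t)) * (Real.cos R + t * Real.sin R) / (1 + t ^ 2)) := by
    simp_rw [← integral_sin_mul_exp_left, ← integral_sin_mul_exp_right]
    apply intervalIntegral_swap_of_continuousOn
    apply Continuous.continuousOn
    unfold Function.uncurry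
    fun_prop
  have hc : Continuous fun t : ℝ =>
      Real.exp (-(R * t)) * (Real.cos R + t * Real.sin R) / (1 + t ^ 2) := by
    apply Continuous.div (by fun_prop) (by fun_prop)
    intro t; positivity
  have hc' : Continuous fun t : ℝ => (1 + t ^ 2)⁻¹ := by
    apply Continuous.inv₀ (by fun_prop)
    intro t; positivity
  rw [intervalIntegral.integral_sub (hc'.intervalIntegrable _ _) (hc.intervalIntegrable _ _),
    integral_inv_one_add_sq, Real.arctan_zero, sub_zero] at hsw
  have hl : ∫ x in (0 : ℝ)..R, Real.sinc x * (1 - Real.exp (-(x * T))) =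
      Si R - ∫ x in (0 : ℝ)..R, Real.sinc x * Real.exp (-(x * T)) := by
    rw [Si, ← intervalIntegral.integral_sub]
    · congr 1; ext x; ring
    · apply Continuous.intervalIntegrable; fun_prop
    · apply Continuous.intervalIntegrable; fun_prop
  have h1 : |∫ x in (0 : ℝ)..R, Real.sinc x * Real.exp (-(x * T))| ≤ 1 / T := by
    refine le_trans ?_ (integral_exp_neg_mul_le (T := R) hT)
    rw [← Real.norm_eq_abs]
    apply intervalIntegral.norm_integral_le_of_norm_le hR.le
    · refine Eventually.of_forall fun x _ => ?_
      rw [norm_mul, Real.norm_eq_abs, Real.norm_eq_abs, Real.abs_exp, mul_comm T]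
      exact mul_le_of_le_one_left (Real.exp_pos _).le (Real.abs_sinc_le_one x)
    · apply Continuous.intervalIntegrable; fun_prop
  have h2 : |∫ t in (0 : ℝ)..T,
      Real.exp (-(R * t)) * (Real.cos R + t * Real.sin R) / (1 + t ^ 2)| ≤ 1 / R := by
    refine le_trans ?_ (integral_exp_neg_mul_le (T := T) hR)
    rw [← Real.norm_eq_abs]
    apply intervalIntegral.norm_integral_le_of_norm_le hT.le
    · refine Eventually.of_forall fun t _ => ?_
      have hp : 0 < 1 + t ^ 2 := by positivity
      rw [norm_div, norm_mul, Real.norm_eq_abs, Real.norm_eq_abs, Real.norm_eq_abs, Real.abs_exp,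
        abs_of_pos hp, div_le_iff₀ hp]
      refine mul_le_mul_of_nonneg_left ?_ (Real.exp_pos _).le
      apply abs_le_of_sq_le_sq _ hp.le
      -- Lagrange's identity: `(cos R + t sin R)² + (t cos R - sin R)² = 1 + t²`, and `1 + t² ≤ (1 +
      -- t²)²`.
      nlinarith [Real.sin_sq_add_cos_sq R, sq_nonneg (t * Real.cos R - Real.sin R), sq_nonneg t]
    · apply Continuous.intervalIntegrable; fun_prop
  rw [abs_le] at *
  constructor <;> linarith [h1.1, h1.2, h2.1, h2.2]

theorem abs_Si_sub_le {R : ℝ} (hR : 0 < R) : |Si R - Real.pi / 2| ≤ 1 / R := by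
  have h1 : Tendsto (fun T : ℝ => |Si R - Real.arctan T|) atTop (𝓝 |Si R - Real.pi / 2|) :=
    ((Real.tendsto_arctan_atTop.mono_right nhdsWithin_le_nhds).const_sub (Si R)).abs
  have h2 : Tendsto (fun T : ℝ => 1 / T + 1 / R) atTop (𝓝 (0 + 1 / R)) :=
    (tendsto_const_nhds.div_atTop tendsto_id).add_const _
  rw [zero_add] at h2
  exact le_of_tendsto_of_tendsto h1 h2
    ((eventually_gt_atTop 0).mono fun T hT => abs_Si_sub_arctan_le hR hT)

theorem Si_neg (x : ℝ) : Si (-x) = -Si x := by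
  have := intervalIntegral.integral_comp_neg (a := 0) (b := x) (fun σ => Real.sinc σ)
  rw [Si, Si, intervalIntegral.integral_symm]
  simp at this
  rw [this]

/-- On `[0, 1]` the integrand is at most 1; beyond 1 the value is within 1 of `π/2 ≤ 2`. The sharp
maximum is not needed, since any bound below `π` serves in `abs_J_le`. -/
theorem abs_Si_le (x : ℝ) : |Si x| ≤ 3 := by
  wlog hx : 0 ≤ x generalizing x
  · have := this (-x) (by linarith)
    rwa [Si_neg, abs_neg] at this
  rcases le_total x 1 with h1 | h1
  · have := intervalIntegral.norm_integral_le_of_norm_le_const (a := 0) (b := x) (C := 1)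
      (f := fun σ => Real.sinc σ) fun σ _ => Real.abs_sinc_le_one σ
    rw [sub_zero, abs_of_nonneg hx, Real.norm_eq_abs] at this
    rw [Si]
    linarith
  · have h2 := abs_Si_sub_le (R := x) (by linarith)
    have h3 : 1 / x ≤ 1 := by rw [div_le_one (by linarith)]; exact h1
    rw [abs_le] at *
    constructor <;> linarith [Real.pi_pos, Real.pi_le_four, h2.1, h2.2]

theorem tendsto_Si_atBot : Tendsto Si atBot (𝓝 (-(Real.pi / 2))) := by
  have h1 : Tendsto Si atTop (𝓝 (Real.pi / 2)) := by
    rw [tendsto_iff_norm_sub_tendsto_zero]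
    refine squeeze_zero' (Eventually.of_forall fun _ => norm_nonneg _)
      ((eventually_gt_atTop 0).mono fun R hR => abs_Si_sub_le hR)
      (tendsto_const_nhds.div_atTop tendsto_id)
  have := (h1.comp tendsto_neg_atBot_atTop).neg
  refine this.congr fun x => ?_
  simp [Si_neg]

theorem hasDerivAt_Si (x : ℝ) : HasDerivAt Si (Real.sinc x) x :=
  intervalIntegral.integral_hasDerivAt_right (Real.continuous_sinc.intervalIntegrable _ _)
    (Real.continuous_sinc.stronglyMeasurableAtFilter _ _) Real.continuous_sinc.continuousAt

theorem abs_J_le (k : ℤ) {h : ℝ} (hh : 0 < h) (x : ℝ) : |J k h x| ≤ 3 / 2 * h := by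
  have h1 := abs_Si_le (Real.pi * (x / h - k))
  rw [J, abs_mul, abs_of_pos hh, mul_comm]
  refine mul_le_mul_of_nonneg_right ?_ hh.le
  have h2 : |1 / Real.pi * Si (Real.pi * (x / h - k))| ≤ 1 := by
    rw [abs_mul, abs_of_pos (by positivity), one_div, inv_mul_le_one₀ Real.pi_pos]
    linarith [Real.pi_gt_three]
  rw [abs_le] at *
  constructor <;> linarith [h2.1, h2.2]

theorem tendsto_J_atBot (k : ℤ) {h : ℝ} (hh : 0 < h) : Tendsto (J k h) atBot (𝓝 0) := by
  have h0 : Tendsto (fun x : ℝ => Real.pi * (x / h - k)) atBot atBot := by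
    apply Tendsto.const_mul_atBot Real.pi_pos
    apply tendsto_atBot_add_const_right
    exact tendsto_id.atBot_div_const hh
  have := (((tendsto_Si_atBot.comp h0).const_mul (1 / Real.pi)).const_add (1 / 2)).const_mul h
  convert! this using 2
  field_simp
  ring

theorem hasDerivAt_J (k : ℤ) {h : ℝ} (hh : 0 < h) (x : ℝ) :
    HasDerivAt (J k h) (Real.sinc (Real.pi * (x / h - k))) x := by
  have h0 : HasDerivAt (fun x : ℝ => Real.pi * (x / h - k)) (Real.pi * (1 / h)) x :=
    (((hasDerivAt_id x).div_const h).sub_const _).const_mul _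
  have := ((((hasDerivAt_Si _).comp x h0).const_mul (1 / Real.pi)).const_add (1 / 2)).const_mul h
  convert! this using 1
  field_simp

theorem integral_sinc_eq_J_sub (k : ℤ) {h : ℝ} (hh : 0 < h) (A X : ℝ) :
    ∫ s in A..X, Real.sinc (Real.pi * (s / h - k)) = J k h X - J k h A := by
  rw [intervalIntegral.integral_eq_sub_of_hasDerivAt (fun x _ => hasDerivAt_J k hh x)]
  apply Continuous.intervalIntegrable
  fun_prop

/-! ### Residues on a rectangle -/

/-- The integral of `g` along the boundary of the rectangle with corners `a + b i` and `c + e i`,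
counterclockwise. -/
noncomputable def rectIntegral (g : ℂ → ℂ) (a c b e : ℝ) : ℂ :=
  (∫ x : ℝ in a..c, g (x + b * Complex.I)) - (∫ x : ℝ in a..c, g (x + e * Complex.I)) +
    Complex.I * (∫ y : ℝ in b..e, g (c + y * Complex.I)) -
    Complex.I * (∫ y : ℝ in b..e, g (a + y * Complex.I))

/-- The boundary of the rectangle `[a, c] × [b, e]`. -/
def rectBoundary (a c b e : ℝ) : Set ℂ :=
  {z | z.re ∈ Set.Icc a c ∧ z.im ∈ Set.Icc b e ∧ (z.re = a ∨ z.re = c ∨ z.im = b ∨ z.im = e)}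

section
variable {a c b e : ℝ}

theorem mem_rectBoundary_horizontal (hbe : b < e) {x : ℝ} (hx : x ∈ Set.Icc a c) {y : ℝ}
    (hy : y = b ∨ y = e) : (x + y * Complex.I : ℂ) ∈ rectBoundary a c b e := by
  rcases hy with rfl | rfl <;> simp [rectBoundary, hbe.le, hx.1, hx.2]

theorem mem_rectBoundary_vertical (hac : a < c) {y : ℝ} (hy : y ∈ Set.Icc b e) {x : ℝ}
    (hx : x = a ∨ x = c) : (x + y * Complex.I : ℂ) ∈ rectBoundary a c b e := by
  rcases hx with rfl | rfl <;> simp [rectBoundary, hac.le, hy.1, hy.2]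

theorem rectIntegral_congr (hac : a < c) (hbe : b < e) {g₁ g₂ : ℂ → ℂ}
    (hg : Set.EqOn g₁ g₂ (rectBoundary a c b e)) :
    rectIntegral g₁ a c b e = rectIntegral g₂ a c b e := by
  unfold rectIntegral
  congr 1
  · congr 1
    · congr 1 <;> refine intervalIntegral.integral_congr fun x hx => hg ?_ <;>
        rw [Set.uIcc_of_le hac.le] at hx
      · exact mem_rectBoundary_horizontal hbe hx (Or.inl rfl)
      · exact mem_rectBoundary_horizontal hbe hx (Or.inr rfl)
    · congr 1
      refine intervalIntegral.integral_congr fun y hy => hg ?_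
      rw [Set.uIcc_of_le hbe.le] at hy
      exact mem_rectBoundary_vertical hac hy (Or.inr rfl)
  · congr 1
    refine intervalIntegral.integral_congr fun y hy => hg ?_
    rw [Set.uIcc_of_le hbe.le] at hy
    exact mem_rectBoundary_vertical hac hy (Or.inl rfl)

theorem continuousOn_horizontal {E : Type*} [TopologicalSpace E] (hbe : b < e) {g : ℂ → E}
    (hg : ContinuousOn g (rectBoundary a c b e)) {y : ℝ} (hy : y = b ∨ y = e) :
    ContinuousOn (fun x : ℝ => g (x + y * Complex.I)) (Set.Icc a c) :=
  hg.comp (by fun_prop) fun _ hx => mem_rectBoundary_horizontal hbe hx hy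

theorem continuousOn_vertical {E : Type*} [TopologicalSpace E] (hac : a < c) {g : ℂ → E}
    (hg : ContinuousOn g (rectBoundary a c b e)) {x : ℝ} (hx : x = a ∨ x = c) :
    ContinuousOn (fun y : ℝ => g (x + y * Complex.I)) (Set.Icc b e) :=
  hg.comp (by fun_prop) fun _ hy => mem_rectBoundary_vertical hac hy hx

theorem rectIntegral_add (hac : a < c) (hbe : b < e) {g₁ g₂ : ℂ → ℂ}
    (h₁ : ContinuousOn g₁ (rectBoundary a c b e)) (h₂ : ContinuousOn g₂ (rectBoundary a c b e)) :
    rectIntegral (fun z => g₁ z + g₂ z) a c b e =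
      rectIntegral g₁ a c b e + rectIntegral g₂ a c b e := by
  have H : ∀ {g : ℂ → ℂ}, ContinuousOn g (rectBoundary a c b e) → ∀ {y : ℝ}, y = b ∨ y = e →
      IntervalIntegrable (fun x : ℝ => g (x + y * Complex.I)) volume a c := fun hg y hy =>
    ContinuousOn.intervalIntegrable_of_Icc hac.le (continuousOn_horizontal hbe hg hy)
  have V : ∀ {g : ℂ → ℂ}, ContinuousOn g (rectBoundary a c b e) → ∀ {x : ℝ}, x = a ∨ x = c →
      IntervalIntegrable (fun y : ℝ => g (x + y * Complex.I)) volume b e := fun hg y hy =>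
    ContinuousOn.intervalIntegrable_of_Icc hbe.le (continuousOn_vertical hac hg hy)
  unfold rectIntegral
  rw [intervalIntegral.integral_add (H h₁ (.inl rfl)) (H h₂ (.inl rfl)),
    intervalIntegral.integral_add (H h₁ (.inr rfl)) (H h₂ (.inr rfl)),
    intervalIntegral.integral_add (V h₁ (.inl rfl)) (V h₂ (.inl rfl)),
    intervalIntegral.integral_add (V h₁ (.inr rfl)) (V h₂ (.inr rfl))]
  ring

theorem rectIntegral_const_mul (r : ℂ) (g : ℂ → ℂ) :
    rectIntegral (fun z => r * g z) a c b e = r * rectIntegral g a c b e := by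
  simp only [rectIntegral, intervalIntegral.integral_const_mul]
  ring

theorem rectIntegral_eq_zero (hac : a < c) (hbe : b < e) {g : ℂ → ℂ}
    (hg : DifferentiableOn ℂ g (Set.Icc a c ×ℂ Set.Icc b e)) : rectIntegral g a c b e = 0 := by
  have := Complex.integral_boundary_rect_eq_zero_of_differentiableOn g ⟨a, b⟩ ⟨c, e⟩
    (by rwa [Set.uIcc_of_le hac.le, Set.uIcc_of_le hbe.le])
  simpa [rectIntegral] using this

theorem integral_inv_of_log {γ : ℝ → ℂ} {γ' : ℂ} {s t : ℝ} (hst : s ≤ t)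
    (hγ : ∀ u, HasDerivAt γ γ' u) (hsl : ∀ u ∈ Set.Icc s t, γ u ∈ Complex.slitPlane) :
    γ' * ∫ u in s..t, (γ u)⁻¹ = Complex.log (γ t) - Complex.log (γ s) := by
  rw [← Set.uIcc_of_le hst] at hsl
  rw [← intervalIntegral.integral_const_mul,
    intervalIntegral.integral_eq_sub_of_hasDerivAt (f := fun u => Complex.log (γ u))]
  · intro u hu
    convert! (hγ u).clog_real (hsl u hu) using 1
  · apply ContinuousOn.intervalIntegrable
    apply ContinuousOn.mul continuousOn_const
    apply ContinuousOn.inv₀ (fun u _ => (hγ u).continuousAt.continuousWithinAt)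
    exact fun u hu => Complex.slitPlane_ne_zero (hsl u hu)

/-- On three sides `log (z - p)` is a primitive. The left side crosses the branch cut, so `log (-(z
- p))` is used there; it differs from `log (z - p)` by `∓πi` at the two left corners, and these two
jumps add up to `2πi`. -/
theorem rectIntegral_inv_sub {p : ℂ} (ha : a < p.re) (hc : p.re < c) (hb : b < p.im)
    (he : p.im < e) : rectIntegral (fun z => (z - p)⁻¹) a c b e = 2 * Real.pi * Complex.I := by
  have hH : ∀ y u : ℝ, HasDerivAt (fun x : ℝ => (x + y * Complex.I - p : ℂ)) 1 u := fun y u =>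
    ((Complex.ofRealCLM.hasDerivAt (x := u)).add_const _).sub_const _
  have hV : ∀ x u : ℝ, HasDerivAt (fun y : ℝ => (x + y * Complex.I - p : ℂ)) Complex.I u := by
    intro x u
    have := (((Complex.ofRealCLM.hasDerivAt (x := u)).mul_const Complex.I).const_add
      (x : ℂ)).sub_const p
    simpa using this
  have hVn : ∀ x u : ℝ, HasDerivAt (fun y : ℝ => -(x + y * Complex.I - p : ℂ)) (-Complex.I) u :=
    fun x u => (hV x u).neg
  have h1 := integral_inv_of_log (s := a) (t := c) (by linarith) (hH b)
    (fun u _ => Or.inr (by simp; linarith))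
  have h2 := integral_inv_of_log (s := a) (t := c) (by linarith) (hH e)
    (fun u _ => Or.inr (by simp; linarith))
  have h3 := integral_inv_of_log (s := b) (t := e) (by linarith) (hV c)
    (fun u _ => Or.inl (by simp; linarith))
  have h4 := integral_inv_of_log (s := b) (t := e) (by linarith) (hVn a)
    (fun u _ => Or.inl (by simp; linarith))
  have h5 : Complex.I * ∫ y : ℝ in b..e, (a + y * Complex.I - p : ℂ)⁻¹ =
      Complex.log (-(a + e * Complex.I - p)) - Complex.log (-(a + b * Complex.I - p)) := by
    rw [← h4]
    simp_rw [inv_neg]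
    rw [intervalIntegral.integral_neg]
    ring
  rw [one_mul] at h1 h2
  unfold rectIntegral
  rw [h1, h2, h3, h5]
  have ht : Complex.log (-(a + e * Complex.I - p)) =
      Complex.log (a + e * Complex.I - p) - Real.pi * Complex.I := by
    rw [Complex.log, Complex.log, norm_neg,
      Complex.arg_neg_eq_arg_sub_pi_of_im_pos (by simp; linarith)]
    push_cast; ring
  have hbt : Complex.log (-(a + b * Complex.I - p)) =
      Complex.log (a + b * Complex.I - p) + Real.pi * Complex.I := by
    rw [Complex.log, Complex.log, norm_neg,
      Complex.arg_neg_eq_arg_add_pi_of_im_neg (by simp; linarith)]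
    push_cast; ring
  rw [ht, hbt]
  ring

/-- The residue theorem on a rectangle, for finitely many simple poles. -/
theorem rectIntegral_eq_sum_residues (hac : a < c) (hbe : b < e) {U : Set ℂ} (hU : IsOpen U)
    (hRU : Set.Icc a c ×ℂ Set.Icc b e ⊆ U) (S : Finset ℂ) (r : ℂ → ℂ) :
    ∀ g : ℂ → ℂ, (∀ p ∈ S, p ∈ Set.Ioo a c ×ℂ Set.Ioo b e) →
      DifferentiableOn ℂ g (U \ S) →
      (∀ p ∈ S, Tendsto (fun z => (z - p) * g z) (𝓝[≠] p) (𝓝 (r p))) →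
      rectIntegral g a c b e = 2 * Real.pi * Complex.I * ∑ p ∈ S, r p := by
  classical
  have hnb : ∀ p ∈ Set.Ioo a c ×ℂ Set.Ioo b e, p ∉ rectBoundary a c b e := by
    rintro p ⟨h1, h2⟩ ⟨-, -, h⟩
    simp only [Set.mem_preimage, Set.mem_Ioo] at h1 h2
    rcases h with h | h | h | h <;> linarith [h1.1, h1.2, h2.1, h2.2]
  have hBU : rectBoundary a c b e ⊆ U := fun z hz => hRU ⟨hz.1, hz.2.1⟩
  -- The function `g` stays quantified: the inductive step applies the hypothesis to `g` with its
  -- pole at `p` removed.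
  induction S using Finset.induction_on with
  | empty =>
    intro g _ hg _
    rw [rectIntegral_eq_zero hac hbe]
    · simp
    · refine hg.mono ?_
      simpa using hRU
  | insert p S hp ih =>
    intro g hS hg hr
    have hpS : p ∈ Set.Ioo a c ×ℂ Set.Ioo b e := hS p (Finset.mem_insert_self _ _)
    have hIU : Set.Ioo a c ×ℂ Set.Ioo b e ⊆ U := fun z hz =>
      hRU ⟨Set.Ioo_subset_Icc_self hz.1, Set.Ioo_subset_Icc_self hz.2⟩
    have hpU : p ∈ U := hIU hpS
    set W : Set ℂ := U \ (S : Set ℂ) with hW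
    have hWo : IsOpen W := hU.sdiff S.finite_toSet.isClosed
    have hpW : p ∈ W := ⟨hpU, by simpa using hp⟩
    have hWsub : W \ {p} ⊆ U \ ((insert p S : Finset ℂ) : Set ℂ) := by
      rintro z ⟨⟨h1, h2⟩, h3⟩
      refine ⟨h1, ?_⟩
      simp only [Finset.coe_insert, Set.mem_insert_iff, not_or]
      exact ⟨h3, h2⟩
    set q : ℂ → ℂ := fun z => g z - r p * (z - p)⁻¹ with hq
    have hinv : ∀ z, z ≠ p → DifferentiableAt ℂ (fun z => r p * (z - p)⁻¹) z := fun z hz =>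
      ((differentiableAt_id.sub_const p).inv (sub_ne_zero.mpr hz)).const_mul _
    have hqd : DifferentiableOn ℂ q (W \ {p}) :=
      (hg.mono hWsub).sub fun z hz => (hinv z hz.2).differentiableWithinAt
    have hqt : Tendsto (fun z => (z - p) * q z) (𝓝[≠] p) (𝓝 0) := by
      have := (hr p (Finset.mem_insert_self _ _)).sub_const (r p)
      rw [sub_self] at this
      refine this.congr' ?_
      filter_upwards [self_mem_nhdsWithin] with z hz
      have : z - p ≠ 0 := sub_ne_zero.mpr hz
      simp only [hq]
      field_simp
    -- With the principal part subtracted, `(z - p) q(z) → 0`, which is Riemann's condition for a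
    -- removable singularity.
    have hlo : (fun z => q z - q p) =o[𝓝[≠] p] fun z => (z - p)⁻¹ := by
      rw [Asymptotics.isLittleO_iff_tendsto']
      · have h2 : Tendsto (fun z => (z - p) * q p) (𝓝[≠] p) (𝓝 0) := by
          have : Continuous fun z : ℂ => (z - p) * q p := by fun_prop
          simpa using (this.tendsto p).mono_left nhdsWithin_le_nhds
        have := hqt.sub h2
        rw [sub_self] at this
        refine this.congr fun z => ?_
        rw [div_inv_eq_mul]; ring
      · filter_upwards [self_mem_nhdsWithin] with z hz h0
        exact absurd (inv_eq_zero.mp h0) (sub_ne_zero.mpr hz)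
    have hQd := Complex.differentiableOn_update_limUnder_of_isLittleO (hWo.mem_nhds hpW) hqd hlo
    set Q := Function.update q p (limUnder (𝓝[≠] p) q) with hQ
    have hQq : ∀ z, z ≠ p → Q z = q z := fun z hz => Function.update_of_ne hz _ _
    have hQI := ih Q (fun p' h' => hS p' (Finset.mem_insert_of_mem h')) hQd (by
      intro p' h'
      have hne : p' ≠ p := fun h => hp (h ▸ h')
      have h1 := hr p' (Finset.mem_insert_of_mem h')
      have h2 : Tendsto (fun z => (z - p') * (r p * (z - p)⁻¹)) (𝓝[≠] p') (𝓝 0) := by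
        have : ContinuousAt (fun z => (z - p') * (r p * (z - p)⁻¹)) p' :=
          (continuousAt_id.sub continuousAt_const).mul (hinv p' hne).continuousAt
        simpa using this.tendsto.mono_left nhdsWithin_le_nhds
      have h3 := h1.sub h2
      rw [sub_zero] at h3
      refine h3.congr' ?_
      filter_upwards [mem_nhdsWithin_of_mem_nhds (isOpen_ne.mem_nhds hne)] with z hz
      rw [hQq z hz, hq]; ring)
    have hBne : ∀ z ∈ rectBoundary a c b e, z ≠ p := fun z hz h => hnb p hpS (h ▸ hz)
    have hcongr : rectIntegral g a c b e =
        rectIntegral (fun z => Q z + r p * (z - p)⁻¹) a c b e := by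
      apply rectIntegral_congr hac hbe
      intro z hz
      simp only [hQq z (hBne z hz), hq]
      ring
    have hQc : ContinuousOn Q (rectBoundary a c b e) :=
      hQd.continuousOn.mono fun z hz =>
        ⟨hBU hz, fun h => hnb z (hS z (Finset.mem_insert_of_mem h)) hz⟩
    have hic : ContinuousOn (fun z => r p * (z - p)⁻¹) (rectBoundary a c b e) :=
      fun z hz => (hinv z (hBne z hz)).continuousAt.continuousWithinAt
    rw [hcongr, rectIntegral_add hac hbe hQc hic, rectIntegral_const_mul, hQI,
      rectIntegral_inv_sub hpS.1.1 hpS.1.2 hpS.2.1 hpS.2.2, Finset.sum_insert hp]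
    ring

end

/-! ### The integrated kernel, and the size of the sine on the contour -/

/-- The left side is `cos (arctan u) = sin (π/2 ∓ arctan u)`, and `sin y ≤ y` for `y ≥ 0`. -/
theorem inv_sqrt_one_add_sq_le (u : ℝ) :
    (Real.sqrt (1 + u ^ 2))⁻¹ ≤ Real.pi / 2 - Real.arctan u ∧
      (Real.sqrt (1 + u ^ 2))⁻¹ ≤ Real.pi / 2 + Real.arctan u := by
  have h := Real.cos_arctan u
  rw [one_div] at h
  rw [← h]
  have h1 := Real.arctan_lt_pi_div_two u
  have h2 := Real.neg_pi_div_two_lt_arctan u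
  constructor
  · rw [← Real.sin_pi_div_two_sub]
    exact Real.sin_le (by linarith)
  · rw [← Real.cos_neg, ← Real.sin_pi_div_two_sub, sub_neg_eq_add]
    exact Real.sin_le (by linarith)

theorem norm_sub_ofReal_inv (z : ℂ) (hz : z.im ≠ 0) (s : ℝ) :
    ‖(z - s)⁻¹‖ = |z.im|⁻¹ * (Real.sqrt (1 + ((s - z.re) / |z.im|) ^ 2))⁻¹ := by
  have hp : 0 < |z.im| := abs_pos.mpr hz
  rw [norm_inv, ← mul_inv]
  congr 1
  rw [Complex.norm_eq_sqrt_sq_add_sq, ← Real.sqrt_sq hp.le, ← Real.sqrt_mul (by positivity),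
    Real.sqrt_sq hp.le]
  congr 1
  have : |z.im| ^ 2 = z.im ^ 2 := sq_abs _
  field_simp
  rw [this]
  simp
  ring

/-- Integrate by parts. The new integral is at most `c⁻¹ ∫ |z - s|⁻² ds`, a difference of
arctangents. By `inv_sqrt_one_add_sq_le` the boundary terms at `A` and `X` are at most the two
missing arctangent tails, so the total never exceeds the integral over the whole line, whatever `A`
and `X`. -/
theorem norm_integral_sin_div_le {c : ℝ} (hc : 0 < c) {A X : ℝ} (hAX : A ≤ X) {z : ℂ}
    (hz : z.im ≠ 0) :
    ‖∫ s in A..X, (Real.sin (c * s) : ℂ) * (z - s)⁻¹‖ ≤ Real.pi / (c * |z.im|) := by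
  have hp : 0 < |z.im| := abs_pos.mpr hz
  have hne : ∀ s : ℝ, z - s ≠ 0 := fun s h0 => hz (by simpa using congrArg Complex.im h0)
  have hci : Continuous fun s : ℝ => (z - s)⁻¹ := Continuous.inv₀ (by fun_prop) hne
  have hd : ∀ s ∈ Set.uIcc A X, HasDerivAt
      (fun s : ℝ => -((Real.cos (c * s) / c : ℝ) : ℂ) * (z - s)⁻¹)
      ((Real.sin (c * s) : ℂ) * (z - s)⁻¹ -
        ((Real.cos (c * s) / c : ℝ) : ℂ) * ((z - s)⁻¹) ^ 2) s := by
    intro s _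
    have h1 : HasDerivAt (fun s : ℝ => Real.cos (c * s) / c) (-Real.sin (c * s)) s := by
      have h0 : HasDerivAt (fun s : ℝ => c * s) c s := by
        simpa using (hasDerivAt_id s).const_mul c
      convert! (h0.cos).div_const c using 1
      field_simp
    have h2 : HasDerivAt (fun s : ℝ => (z - s)⁻¹) (((z - s)⁻¹) ^ 2) s := by
      have h0 : HasDerivAt (fun s : ℝ => z - (s : ℂ)) (-1) s :=
        (Complex.ofRealCLM.hasDerivAt (x := s)).const_sub z
      convert! h0.inv (hne s) using 1
      simp
    convert! (h1.ofReal_comp.neg).mul h2 using 1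
    simp only [Pi.neg_apply]
    push_cast
    ring
  have hint : ∫ s in A..X, (Real.sin (c * s) : ℂ) * (z - s)⁻¹ =
      (-((Real.cos (c * X) / c : ℝ) : ℂ) * (z - X)⁻¹ +
        ((Real.cos (c * A) / c : ℝ) : ℂ) * (z - A)⁻¹) +
      ∫ s in A..X, ((Real.cos (c * s) / c : ℝ) : ℂ) * ((z - s)⁻¹) ^ 2 := by
    have := intervalIntegral.integral_eq_sub_of_hasDerivAt hd
      (by apply Continuous.intervalIntegrable; fun_prop)
    rw [intervalIntegral.integral_sub (by apply Continuous.intervalIntegrable; fun_prop)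
      (by apply Continuous.intervalIntegrable; fun_prop)] at this
    rw [sub_eq_iff_eq_add] at this
    rw [this]
    ring
  have hcos : ∀ s, |Real.cos (c * s) / c| ≤ c⁻¹ := fun s => by
    rw [abs_div, abs_of_pos hc, div_eq_mul_inv]
    exact mul_le_of_le_one_left (by positivity) (Real.abs_cos_le_one _)
  have hbd : ∀ s, ‖((Real.cos (c * s) / c : ℝ) : ℂ) * (z - s)⁻¹‖ ≤ c⁻¹ * ‖(z - s)⁻¹‖ := fun s => by
    rw [norm_mul, Complex.norm_real]
    exact mul_le_mul_of_nonneg_right (hcos s) (norm_nonneg _)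
  have hat : ∀ s ∈ Set.uIcc A X, HasDerivAt
      (fun s : ℝ => c⁻¹ * |z.im|⁻¹ * Real.arctan ((s - z.re) / |z.im|))
      (c⁻¹ * ‖(z - s)⁻¹‖ ^ 2) s := by
    intro s _
    have h0 : HasDerivAt (fun s : ℝ => (s - z.re) / |z.im|) (1 / |z.im|) s :=
      ((hasDerivAt_id s).sub_const _).div_const _
    convert! (h0.arctan).const_mul (c⁻¹ * |z.im|⁻¹) using 1
    rw [norm_sub_ofReal_inv z hz, mul_pow, inv_pow, inv_pow, Real.sq_sqrt (by positivity)]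
    field_simp
  have h3 : ‖∫ s in A..X, ((Real.cos (c * s) / c : ℝ) : ℂ) * ((z - s)⁻¹) ^ 2‖ ≤
      c⁻¹ * |z.im|⁻¹ * Real.arctan ((X - z.re) / |z.im|) -
      c⁻¹ * |z.im|⁻¹ * Real.arctan ((A - z.re) / |z.im|) := by
    rw [← intervalIntegral.integral_eq_sub_of_hasDerivAt hat
      (by apply Continuous.intervalIntegrable; fun_prop)]
    apply intervalIntegral.norm_integral_le_of_norm_le hAX
    · refine Eventually.of_forall fun s _ => ?_
      rw [norm_mul, Complex.norm_real, norm_pow]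
      exact mul_le_mul_of_nonneg_right (hcos s) (by positivity)
    · apply Continuous.intervalIntegrable; fun_prop
  have hX := hbd X
  have hA := hbd A
  rw [norm_sub_ofReal_inv z hz] at hX hA
  have hX' := mul_le_mul_of_nonneg_left (inv_sqrt_one_add_sq_le ((X - z.re) / |z.im|)).1
    (show 0 ≤ c⁻¹ * |z.im|⁻¹ by positivity)
  have hA' := mul_le_mul_of_nonneg_left (inv_sqrt_one_add_sq_le ((A - z.re) / |z.im|)).2
    (show 0 ≤ c⁻¹ * |z.im|⁻¹ by positivity)
  rw [hint]
  refine (norm_add_le _ _).trans ?_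
  have h4 := norm_add_le (-((Real.cos (c * X) / c : ℝ) : ℂ) * (z - X)⁻¹)
    (((Real.cos (c * A) / c : ℝ) : ℂ) * (z - A)⁻¹)
  rw [neg_mul, norm_neg, ← neg_mul] at h4
  have h5 : Real.pi / (c * |z.im|) = c⁻¹ * |z.im|⁻¹ * Real.pi := by field_simp
  rw [h5]
  linarith

theorem sinh_abs_le_norm_sin (z : ℂ) : Real.sinh |z.im| ≤ ‖Complex.sin z‖ := by
  have h : ‖Complex.sin z‖ ^ 2 = Real.sin z.re ^ 2 + Real.sinh z.im ^ 2 := by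
    rw [Complex.sq_norm, Complex.sin_eq, ← Complex.ofReal_sin, ← Complex.ofReal_cos,
      ← Complex.ofReal_cosh, ← Complex.ofReal_sinh, ← Complex.ofReal_mul, ← Complex.ofReal_mul,
      Complex.normSq_add_mul_I, mul_pow, mul_pow, Real.cosh_sq, Real.cos_sq']
    ring
  refine (le_abs_self _).trans (abs_le_of_sq_le_sq ?_ (norm_nonneg _))
  rw [h]
  have : Real.sinh |z.im| ^ 2 = Real.sinh z.im ^ 2 := by
    rcases abs_choice z.im with h | h <;> simp [h]
  rw [this]
  nlinarith [sq_nonneg (Real.sin z.re)]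

/-- Serves the vertical sides of the contour, placed midway between grid points; there `|sin z| =
cosh (Im z)`. -/
theorem one_le_norm_sin {z : ℂ} (hz : Real.cos z.re = 0) : 1 ≤ ‖Complex.sin z‖ := by
  have h : ‖Complex.sin z‖ ^ 2 = Real.cosh z.im ^ 2 := by
    have hs : Real.sin z.re ^ 2 = 1 := by nlinarith [Real.sin_sq_add_cos_sq z.re]
    rw [Complex.sq_norm, Complex.sin_eq, ← Complex.ofReal_sin, ← Complex.ofReal_cos,
      ← Complex.ofReal_cosh, ← Complex.ofReal_sinh, ← Complex.ofReal_mul, ← Complex.ofReal_mul,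
      Complex.normSq_add_mul_I, mul_pow, mul_pow, hs, hz]
    ring
  have h2 := Real.one_le_cosh z.im
  nlinarith [norm_nonneg (Complex.sin z)]

/-! ### The Sinc interpolation error as a contour integral -/

theorem tendsto_sub_mul_div {F D : ℂ → ℂ} {p D' : ℂ} (hF : ContinuousAt F p)
    (hD : HasDerivAt D D' p) (h0 : D p = 0) (hD' : D' ≠ 0) :
    Tendsto (fun z => (z - p) * (F z / D z)) (𝓝[≠] p) (𝓝 (F p / D')) := by
  have h1 := hasDerivAt_iff_tendsto_slope.mp hD
  have h2 := (hF.tendsto.mono_left nhdsWithin_le_nhds).div h1 hD'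
  refine h2.congr fun z => ?_
  change F z / slope D p z = _
  rw [slope_def_field, h0, sub_zero, div_div_eq_mul_div]
  ring

theorem sinc_shift {h x : ℝ} (hh : 0 < h) (k : ℤ) (hx : x ≠ k * h) :
    Real.sinc (Real.pi * (x / h - k)) =
      Real.sin (Real.pi / h * x) * Real.cos (k * Real.pi) / (Real.pi / h * (x - k * h)) := by
  have hne : x - k * h ≠ 0 := sub_ne_zero.mpr hx
  have h1 : Real.pi * (x / h - k) = Real.pi / h * (x - k * h) := by field_simp
  have h2 : Real.pi / h * (x - k * h) = Real.pi / h * x - k * Real.pi := by field_simp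
  rw [h1, Real.sinc_of_ne_zero (by positivity), h2, Real.sin_sub, Real.sin_int_mul_pi]
  ring

theorem cos_int_mul_pi_sq (k : ℤ) : Real.cos (k * Real.pi) ^ 2 = 1 := by
  have := Real.sin_sq_add_cos_sq (k * Real.pi)
  rw [Real.sin_int_mul_pi] at this
  linarith

/-- The contour-integral form of the Sinc interpolation error. -/
theorem sinc_error_eq {d d' h : ℝ} (hh : 0 < h) (hd' : 0 < d') (hdd : d' < d) {F : ℂ → ℂ}
    (hF : DifferentiableOn ℂ F (strip d)) (n : ℕ) {x : ℝ} (hx : |x| < (n + 1 / 2) * h)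
    (hgrid : ∀ k : ℤ, x ≠ k * h) :
    2 * Real.pi * Complex.I * (F x - ∑ k ∈ Finset.Icc (-(n : ℤ)) n,
        F ((k * h : ℝ) : ℂ) * (Real.sinc (Real.pi * (x / h - k)) : ℂ)) =
      rectIntegral (fun z => F z / Complex.sin (Real.pi / h * z) *
        ((Real.sin (Real.pi / h * x) : ℂ) * (z - x)⁻¹))
        (-((n + 1 / 2) * h)) ((n + 1 / 2) * h) (-d') d' := by
  classical
  set c : ℝ := Real.pi / h with hc
  have hc0 : 0 < c := by positivity
  have hch : c * h = Real.pi := by rw [hc]; field_simp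
  have hR : 0 < (n + 1 / 2 : ℝ) * h := by positivity
  set T : Finset ℤ := Finset.Icc (-(n : ℤ)) n with hT
  set ι : ℤ → ℂ := fun k => ((k * h : ℝ) : ℂ) with hι
  have hιinj : Set.InjOn ι T := by
    intro k _ l _ hkl
    have h1 : (k * h : ℝ) = l * h := Complex.ofReal_injective hkl
    exact_mod_cast mul_right_cancel₀ hh.ne' h1
  have hxT : (x : ℂ) ∉ T.image ι := by
    simp only [Finset.mem_image, not_exists, not_and]
    intro k _ hk
    exact hgrid k (Complex.ofReal_injective hk).symm
  set D : ℂ → ℂ := fun z => Complex.sin (c * z) * (z - x) with hD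
  have hDd : ∀ z, HasDerivAt D (c * Complex.cos (c * z) * (z - x) + Complex.sin (c * z)) z := by
    intro z
    have h0 : HasDerivAt (fun z : ℂ => (c : ℂ) * z) c z := by
      simpa using (hasDerivAt_id z).const_mul (c : ℂ)
    convert! h0.csin.mul ((hasDerivAt_id z).sub_const (x : ℂ)) using 1
    simp only [id]
    ring
  -- The half-width `(n + 1) h` leaves room around the closed rectangle of half-width `(n + 1/2) h`,
  -- yet admits no zero `kh` of the sine with `|k| > n`.
  set U : Set ℂ := strip d ∩ {z | |z.re| < (n + 1) * h} with hU
  have hUo : IsOpen U := by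
    apply IsOpen.inter
    · exact isOpen_lt (by fun_prop) (by fun_prop)
    · exact isOpen_lt (by fun_prop) (by fun_prop)
  have hsx : Real.sin (c * x) ≠ 0 := by
    intro h0
    obtain ⟨k, hk⟩ := Real.sin_eq_zero_iff.mp h0
    apply hgrid k
    rw [← hch] at hk
    have : c * (k * h) = c * x := by rw [← hk]; ring
    exact (mul_left_cancel₀ hc0.ne' this).symm
  have hD0 : ∀ z ∈ U, D z = 0 → z ∈ insert (x : ℂ) (T.image ι) := by
    rintro z ⟨-, hz⟩ h0
    rcases mul_eq_zero.mp h0 with h1 | h1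
    · obtain ⟨k, hk⟩ := Complex.sin_eq_zero_iff.mp h1
      have hzk : z = ι k := by
        have h2 : (c : ℂ) * z = c * ι k := by
          rw [hk, hι, ← hch]; push_cast; ring
        exact mul_left_cancel₀ (by exact_mod_cast hc0.ne') h2
      refine Finset.mem_insert_of_mem (Finset.mem_image.mpr ⟨k, ?_, hzk.symm⟩)
      rw [hzk] at hz
      simp only [hι, Set.mem_ofPred_eq, Complex.ofReal_re, abs_mul, abs_of_pos hh] at hz
      have h3 : |(k : ℝ)| < n + 1 := lt_of_mul_lt_mul_right hz hh.le
      rw [hT, Finset.mem_Icc]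
      have h4 : |k| < (n : ℤ) + 1 := by exact_mod_cast h3
      rw [abs_lt] at h4
      constructor <;> linarith [h4.1, h4.2]
    · rw [sub_eq_zero] at h1
      rw [h1]; exact Finset.mem_insert_self _ _
  have hcosk : ∀ k : ℤ, Complex.cos (c * ι k) = ((Real.cos (k * Real.pi) : ℝ) : ℂ) := by
    intro k
    rw [Complex.ofReal_cos, hι, ← hch]
    congr 1
    push_cast
    ring
  have hsink : ∀ k : ℤ, Complex.sin (c * ι k) = 0 := by
    intro k
    have : (c : ℂ) * ι k = ((k * Real.pi : ℝ) : ℂ) := by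
      rw [hι, ← hch]; push_cast; ring
    rw [this, ← Complex.ofReal_sin, Real.sin_int_mul_pi, Complex.ofReal_zero]
  have hcosk0 : ∀ k : ℤ, Real.cos (k * Real.pi) ≠ 0 := fun k h0 => by
    have := cos_int_mul_pi_sq k
    rw [h0] at this
    norm_num at this
  have hxk : ∀ k : ℤ, ι k - x ≠ 0 := fun k => by
    rw [hι, ← Complex.ofReal_sub]
    exact_mod_cast sub_ne_zero.mpr (hgrid k).symm
  have hI : ∀ p ∈ insert (x : ℂ) (T.image ι), p ∈
      Set.Ioo (-((n + 1 / 2) * h)) ((n + 1 / 2) * h) ×ℂ Set.Ioo (-d') d' := by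
    intro p hp
    rcases Finset.mem_insert.mp hp with rfl | hp
    · refine ⟨abs_lt.mp hx, ?_⟩
      simp [hd']
    · obtain ⟨k, hk, rfl⟩ := Finset.mem_image.mp hp
      refine ⟨?_, ?_⟩
      · rw [hT, Finset.mem_Icc] at hk
        have h1 : -(n : ℝ) ≤ k := by exact_mod_cast hk.1
        have h2 : (k : ℝ) ≤ n := by exact_mod_cast hk.2
        simp only [hι, Set.mem_preimage, Complex.ofReal_re, Set.mem_Ioo]
        constructor <;> nlinarith
      · simp [hι, hd']
  have hRU : Set.Icc (-((n + 1 / 2) * h)) ((n + 1 / 2) * h) ×ℂ Set.Icc (-d') d' ⊆ U := by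
    rintro z ⟨h1, h2⟩
    refine ⟨(abs_le.mpr h2).trans_lt hdd, (abs_le.mpr h1).trans_lt ?_⟩
    nlinarith
  have hIU : ∀ p ∈ insert (x : ℂ) (T.image ι), p ∈ U := fun p hp =>
    hRU ⟨Set.Ioo_subset_Icc_self (hI p hp).1, Set.Ioo_subset_Icc_self (hI p hp).2⟩
  have hso : IsOpen (strip d) := isOpen_lt (by fun_prop) (by fun_prop)
  -- One formula `F / D'` covers all poles: it equals `F(x) / sin(cx)` at `x` and `F(kh) / (c
  -- cos(kπ) (kh - x))` at `kh`. After multiplication by `sin(cx)` the latter is minus the Sinc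
  -- term.
  have hres := rectIntegral_eq_sum_residues (a := -((n + 1 / 2) * h)) (c := (n + 1 / 2) * h)
    (b := -d') (e := d') (by linarith) (by linarith) hUo hRU (insert (x : ℂ) (T.image ι))
    (fun p => F p / (c * Complex.cos (c * p) * (p - x) + Complex.sin (c * p)))
    (fun z => F z / D z) hI
    (by
      refine DifferentiableOn.div (hF.mono fun z hz => hz.1.1)
        (fun z _ => (hDd z).differentiableAt.differentiableWithinAt) ?_
      exact fun z hz h0 => hz.2 (hD0 z hz.1 h0))
    (by
      intro p hp
      have hFc : ContinuousAt F p :=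
        (hF.differentiableAt (hso.mem_nhds (hIU p hp).1)).continuousAt
      refine tendsto_sub_mul_div hFc (hDd p) ?_ ?_ <;>
        rcases Finset.mem_insert.mp hp with rfl | hp
      · simp [hD]
      · obtain ⟨k, hk, rfl⟩ := Finset.mem_image.mp hp
        simp [hD, hsink]
      · rw [sub_self, mul_zero, zero_add, ← Complex.ofReal_mul, ← Complex.ofReal_sin]
        exact_mod_cast hsx
      · obtain ⟨k, hk, rfl⟩ := Finset.mem_image.mp hp
        rw [hsink, hcosk, add_zero]
        refine mul_ne_zero (mul_ne_zero ?_ ?_) (hxk k)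
        · exact_mod_cast hc0.ne'
        · exact_mod_cast hcosk0 k)
  have hrw : (fun z => F z / Complex.sin (Real.pi / h * z) *
      ((Real.sin (c * x) : ℂ) * (z - x)⁻¹)) =
      fun z => (Real.sin (c * x) : ℂ) * (F z / D z) := by
    ext z
    rw [hD, hc]
    push_cast
    rw [div_mul_eq_div_div, div_eq_mul_inv (F z / _)]
    ring
  rw [hrw, rectIntegral_const_mul, hres, Finset.sum_insert hxT, Finset.sum_image hιinj,
    sub_self, mul_zero, zero_add, ← Complex.ofReal_mul, ← Complex.ofReal_sin]
  have hsxC : (Real.sin (c * x) : ℂ) ≠ 0 := by exact_mod_cast hsx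
  rw [mul_left_comm]
  congr 1
  rw [mul_add, mul_div_cancel₀ _ hsxC, sub_eq_add_neg, ← Finset.sum_neg_distrib, Finset.mul_sum]
  congr 1
  refine Finset.sum_congr rfl fun k _ => ?_
  rw [hsink, hcosk, add_zero, sinc_shift hh k (hgrid k), ← hc]
  -- The sign `cos(kπ)` is in the denominator of the residue and in the numerator of `sinc_shift`;
  -- being its own inverse, it matches.
  have e1 : ((Real.cos (k * Real.pi) : ℝ) : ℂ) ^ 2 = 1 := by exact_mod_cast cos_int_mul_pi_sq k
  have e2 : ((Real.cos (k * Real.pi) : ℝ) : ℂ) ≠ 0 := by exact_mod_cast hcosk0 k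
  have e3 : (c : ℂ) ≠ 0 := by exact_mod_cast hc0.ne'
  have e4 : (x : ℂ) - ι k ≠ 0 := fun h0 => hxk k (by linear_combination -h0)
  have e5 := hxk k
  have e6 : ((c * (x - k * h) : ℝ) : ℂ) = c * (x - ι k) := by rw [hι]; push_cast; ring
  rw [Complex.ofReal_div, Complex.ofReal_mul (Real.sin _), e6]
  generalize (Real.cos (k * Real.pi) : ℂ) = w at *
  rw [show (x : ℂ) - ι k = -(ι k - x) by ring]
  field_simp
  rw [e1]
  exact mul_one _

/-! ### Discretization error for a general function on a strip -/

theorem intervalIntegrable_integral_of_continuousOn {E : Type*} [NormedAddCommGroup E]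
    [NormedSpace ℝ E] {f : ℝ → ℝ → E} {a b c d : ℝ}
    (hf : ContinuousOn (Function.uncurry f) (Set.uIcc a b ×ˢ Set.uIcc c d)) :
    IntervalIntegrable (fun x => ∫ y in c..d, f x y) volume a b := by
  have h1 : IntegrableOn (Function.uncurry f) (Set.uIcc a b ×ˢ Set.uIcc c d) :=
    hf.integrableOn_compact (isCompact_uIcc.prod isCompact_uIcc)
  have h2 := h1.mono_set (Set.prod_mono (Set.uIoc_subset_uIcc (a := a) (b := b))
    (Set.uIoc_subset_uIcc (a := c) (b := d)))
  rw [IntegrableOn, Measure.volume_eq_prod, ← Measure.prod_restrict] at h2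
  rw [intervalIntegrable_iff]
  simp_rw [intervalIntegral.intervalIntegral_eq_integral_uIoc]
  exact h2.integral_prod_left.smul _

theorem integral_rectIntegral_swap {A X a c b e : ℝ} (hAX : A ≤ X) (hac : a < c) (hbe : b < e)
    {K : ℝ → ℂ → ℂ}
    (hK : ContinuousOn (Function.uncurry K) (Set.Icc A X ×ˢ rectBoundary a c b e)) :
    ∫ s in A..X, rectIntegral (K s) a c b e =
      rectIntegral (fun z => ∫ s in A..X, K s z) a c b e := by
  have H : ∀ y : ℝ, y = b ∨ y = e → ContinuousOn
      (Function.uncurry fun s x : ℝ => K s (x + y * Complex.I))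
      (Set.uIcc A X ×ˢ Set.uIcc a c) := by
    intro y hy
    rw [Set.uIcc_of_le hAX, Set.uIcc_of_le hac.le]
    exact hK.comp (f := fun q : ℝ × ℝ => (q.1, (q.2 + y * Complex.I : ℂ))) (by fun_prop)
      fun q hq => ⟨hq.1, mem_rectBoundary_horizontal hbe hq.2 hy⟩
  have V : ∀ x : ℝ, x = a ∨ x = c → ContinuousOn
      (Function.uncurry fun s y : ℝ => K s (x + y * Complex.I))
      (Set.uIcc A X ×ˢ Set.uIcc b e) := by
    intro x hx
    rw [Set.uIcc_of_le hAX, Set.uIcc_of_le hbe.le]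
    exact hK.comp (f := fun q : ℝ × ℝ => (q.1, (x + q.2 * Complex.I : ℂ))) (by fun_prop)
      fun q hq => ⟨hq.1, mem_rectBoundary_vertical hac hq.2 hx⟩
  unfold rectIntegral
  have i1 := intervalIntegrable_integral_of_continuousOn (H b (.inl rfl))
  have i2 := intervalIntegrable_integral_of_continuousOn (H e (.inr rfl))
  have i3 := intervalIntegrable_integral_of_continuousOn (V c (.inr rfl))
  have i4 := intervalIntegrable_integral_of_continuousOn (V a (.inl rfl))
  rw [intervalIntegral.integral_sub ((i1.sub i2).add (i3.const_mul _)) (i4.const_mul _),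
    intervalIntegral.integral_add (i1.sub i2) (i3.const_mul _),
    intervalIntegral.integral_sub i1 i2, intervalIntegral.integral_const_mul,
    intervalIntegral.integral_const_mul, intervalIntegral_swap_of_continuousOn (H b (.inl rfl)),
    intervalIntegral_swap_of_continuousOn (H e (.inr rfl)),
    intervalIntegral_swap_of_continuousOn (V c (.inr rfl)),
    intervalIntegral_swap_of_continuousOn (V a (.inl rfl))]

theorem norm_rectIntegral_le {g : ℂ → ℂ} {a c b e H₁ H₂ V : ℝ} (hbe : b ≤ e)
    (h₁ : ‖∫ x : ℝ in a..c, g (x + b * Complex.I)‖ ≤ H₁)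
    (h₂ : ‖∫ x : ℝ in a..c, g (x + e * Complex.I)‖ ≤ H₂)
    (hV : ∀ y ∈ Set.Icc b e, ∀ x : ℝ, x = a ∨ x = c → ‖g (x + y * Complex.I)‖ ≤ V) :
    ‖rectIntegral g a c b e‖ ≤ H₁ + H₂ + 2 * (V * (e - b)) := by
  have hside : ∀ x : ℝ, x = a ∨ x = c →
      ‖Complex.I * ∫ y : ℝ in b..e, g (x + y * Complex.I)‖ ≤ V * (e - b) := by
    intro x hx
    rw [norm_mul, Complex.norm_I, one_mul, ← abs_of_nonneg (sub_nonneg.mpr hbe)]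
    apply intervalIntegral.norm_integral_le_of_norm_le_const
    intro y hy
    rw [Set.uIoc_of_le hbe] at hy
    exact hV y (Set.Ioc_subset_Icc_self hy) x hx
  unfold rectIntegral
  have := hside a (.inl rfl)
  have := hside c (.inr rfl)
  refine (norm_sub_le _ _).trans ?_
  refine (add_le_add_left (norm_add_le _ _) _).trans ?_
  refine (add_le_add_left (add_le_add_left (norm_sub_le _ _) _) _).trans ?_
  linarith

/-- The contour formula is integrated over `[A, X]` and the integrals are swapped. The first term on
the right comes from the horizontal sides, through the interval-free kernel bound. The second comes
from the vertical sides, at distance at least `(n + 1/2) h - Y` from `[A, X]`, and disappears as `n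
→ ∞`. -/
theorem norm_integral_error_le_finite {d d' h : ℝ} (hh : 0 < h) (hd' : 0 < d') (hdd : d' < d)
    {F : ℂ → ℂ} (hF : DifferentiableOn ℂ F (strip d)) {B N₁ : ℝ}
    (hB : ∀ z : ℂ, |z.im| ≤ d' → ‖F z‖ ≤ B)
    (hN : ∀ R : ℝ, 0 ≤ R → ∀ y : ℝ, |y| = d' → ∫ x : ℝ in -R..R, ‖F (x + y * Complex.I)‖ ≤ N₁)
    (n : ℕ) {A X Y : ℝ} (hAX : A ≤ X) (hA : -Y ≤ A) (hX : X ≤ Y) (hY : Y < (n + 1 / 2) * h) :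
    ‖(∫ s : ℝ in A..X, F s) - ∑ k ∈ Finset.Icc (-(n : ℤ)) n,
        F ((k * h : ℝ) : ℂ) * ((J k h X - J k h A : ℝ) : ℂ)‖ ≤
      h * N₁ / (Real.pi * d' * Real.sinh (Real.pi * d' / h)) +
        B * d' * ((X - A) / ((n + 1 / 2) * h - Y)) * 2 / Real.pi := by
  set R : ℝ := (n + 1 / 2) * h with hR
  have hR0 : 0 < R := by positivity
  set c : ℝ := Real.pi / h with hc
  have hc0 : 0 < c := by positivity
  set w : ℂ → ℂ := fun z => F z / Complex.sin (Real.pi / h * z) with hw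
  set κ : ℝ → ℂ → ℂ := fun s z => (Real.sin (c * s) : ℂ) * (z - s)⁻¹ with hκ
  have hcz : ∀ z : ℂ, (Real.pi / h * z : ℂ) = (c : ℂ) * z := fun z => by rw [hc]; push_cast; rfl
  have hFc : ContinuousOn F (strip d) := hF.continuousOn
  have hFline : ∀ y : ℝ, |y| ≤ d' → Continuous fun x : ℝ => F (x + y * Complex.I) := by
    intro y hy
    rw [← continuousOn_univ]
    refine hFc.comp (by fun_prop) fun x _ => ?_
    simp only [strip, Set.mem_ofPred_eq]
    simpa using hy.trans_lt hdd
  have hsH : ∀ x y : ℝ, |y| = d' →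
      Real.sinh (Real.pi * d' / h) ≤ ‖Complex.sin (Real.pi / h * (x + y * Complex.I))‖ := by
    intro x y hy
    refine le_trans (le_of_eq ?_) (sinh_abs_le_norm_sin _)
    rw [hcz]
    simp only [Complex.mul_im, Complex.ofReal_re, Complex.ofReal_im, Complex.add_im,
      Complex.I_re, Complex.I_im, zero_mul, add_zero, zero_add, mul_one, mul_zero]
    rw [abs_mul, abs_of_pos hc0, hy, hc]
    ring_nf
  have hsV : ∀ x y : ℝ, x = -R ∨ x = R →
      1 ≤ ‖Complex.sin (Real.pi / h * (x + y * Complex.I))‖ := by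
    intro x y hx
    apply one_le_norm_sin
    rw [hcz]
    simp only [Complex.mul_re, Complex.ofReal_re, Complex.ofReal_im, Complex.add_re,
      Complex.I_re, Complex.I_im, zero_mul, add_zero, mul_one, mul_zero, sub_zero]
    have hcR : Real.cos (c * R) = 0 := by
      rw [Real.cos_eq_zero_iff]
      refine ⟨n, ?_⟩
      rw [hc, hR]
      push_cast
      field_simp
    rcases hx with rfl | rfl
    · rwa [mul_neg, Real.cos_neg]
    · exact hcR
  have hshpos : 0 < Real.sinh (Real.pi * d' / h) := Real.sinh_pos_iff.mpr (by positivity)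
  have hsin0 : ∀ z ∈ rectBoundary (-R) R (-d') d', Complex.sin (Real.pi / h * z) ≠ 0 := by
    intro z hz h0
    have hzz : (z.re + z.im * Complex.I : ℂ) = z := Complex.re_add_im z
    rcases hz.2.2 with h1 | h1 | h1 | h1
    · have := hsV z.re z.im (.inl h1)
      rw [hzz, h0, norm_zero] at this
      linarith
    · have := hsV z.re z.im (.inr h1)
      rw [hzz, h0, norm_zero] at this
      linarith
    · have := hsH z.re z.im (by rw [h1, abs_neg, abs_of_pos hd'])
      rw [hzz, h0, norm_zero] at this
      linarith
    · have := hsH z.re z.im (by rw [h1, abs_of_pos hd'])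
      rw [hzz, h0, norm_zero] at this
      linarith
  have hwc : ContinuousOn w (rectBoundary (-R) R (-d') d') := by
    refine ContinuousOn.div (hFc.mono ?_) (by fun_prop) hsin0
    exact fun z hz => (abs_le.mpr hz.2.1).trans_lt hdd
  have hzs : ∀ z ∈ rectBoundary (-R) R (-d') d', ∀ s ∈ Set.Icc A X, z - s ≠ 0 := by
    intro z hz s hs h0
    have h1 : z = s := sub_eq_zero.mp h0
    rw [h1] at hz
    rcases hz.2.2 with h1 | h1 | h1 | h1 <;> simp only [Complex.ofReal_re, Complex.ofReal_im] at h1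
      <;> linarith [hs.1, hs.2]
  have hK : ContinuousOn (Function.uncurry fun s z => w z * κ s z)
      (Set.Icc A X ×ˢ rectBoundary (-R) R (-d') d') := by
    refine ContinuousOn.mul (hwc.comp continuousOn_snd fun q hq => hq.2) ?_
    refine ContinuousOn.mul (by fun_prop) ?_
    exact ContinuousOn.inv₀ (by fun_prop) fun q hq => hzs q.2 hq.2 q.1 hq.1
  have hswap := integral_rectIntegral_swap hAX (by linarith) (by linarith) hK
  have hlhs : ∫ s in A..X, rectIntegral (fun z => w z * κ s z) (-R) R (-d') d' =
      2 * Real.pi * Complex.I * ((∫ s : ℝ in A..X, F s) - ∑ k ∈ Finset.Icc (-(n : ℤ)) n,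
        F ((k * h : ℝ) : ℂ) * ((J k h X - J k h A : ℝ) : ℂ)) := by
    -- The contour formula excludes grid points, which form a null set.
    have hcount : (Set.range fun k : ℤ => (k * h : ℝ)).Countable := Set.countable_range _
    have hae : ∀ᵐ s : ℝ, s ∈ Set.uIoc A X →
        rectIntegral (fun z => w z * κ s z) (-R) R (-d') d' =
        2 * Real.pi * Complex.I * (F s - ∑ k ∈ Finset.Icc (-(n : ℤ)) n,
        F ((k * h : ℝ) : ℂ) * (Real.sinc (Real.pi * (s / h - k)) : ℂ)) := by
      filter_upwards [hcount.ae_notMem volume] with s hs hsI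
      rw [Set.uIoc_of_le hAX] at hsI
      rw [sinc_error_eq hh hd' hdd hF n (abs_lt.mpr ⟨by linarith [hsI.1], by linarith [hsI.2]⟩)
        fun k hk => hs ⟨k, hk.symm⟩]
    rw [intervalIntegral.integral_congr_ae hae, intervalIntegral.integral_const_mul]
    congr 1
    have hFr : IntervalIntegrable (fun s : ℝ => F s) volume A X := by
      have := hFline 0 (by simpa using hd'.le)
      simp only [Complex.ofReal_zero, zero_mul, add_zero] at this
      exact this.intervalIntegrable _ _
    have hsc : ∀ k : ℤ, IntervalIntegrable (fun s : ℝ => F ((k * h : ℝ) : ℂ) *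
        (Real.sinc (Real.pi * (s / h - k)) : ℂ)) volume A X := fun k => by
      apply Continuous.intervalIntegrable
      refine continuous_const.mul (Complex.continuous_ofReal.comp ?_)
      fun_prop
    have hsum : IntervalIntegrable (fun s : ℝ => ∑ k ∈ Finset.Icc (-(n : ℤ)) n,
        F ((k * h : ℝ) : ℂ) * (Real.sinc (Real.pi * (s / h - k)) : ℂ)) volume A X := by
      simpa only [Finset.sum_fn] using IntervalIntegrable.sum (Finset.Icc (-(n : ℤ)) n)
        fun k _ => hsc k
    rw [intervalIntegral.integral_sub hFr hsum,
      intervalIntegral.integral_finsetSum fun k _ => hsc k]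
    congr 1
    refine Finset.sum_congr rfl fun k _ => ?_
    rw [intervalIntegral.integral_const_mul, intervalIntegral.integral_ofReal,
      integral_sinc_eq_J_sub k hh]
  have hHor : ∀ y : ℝ, |y| = d' →
      ‖∫ x : ℝ in -R..R, ∫ s in A..X, w (x + y * Complex.I) * κ s (x + y * Complex.I)‖ ≤
        N₁ * (h / (d' * Real.sinh (Real.pi * d' / h))) := by
    intro y hy
    refine le_trans ?_ (mul_le_mul_of_nonneg_right (hN R hR0.le y hy) (by positivity))
    rw [← intervalIntegral.integral_mul_const]
    apply intervalIntegral.norm_integral_le_of_norm_le (by linarith)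
    · refine Eventually.of_forall fun x _ => ?_
      rw [intervalIntegral.integral_const_mul, norm_mul, hw]
      simp only
      rw [norm_div, div_mul_eq_mul_div, mul_div_assoc]
      refine mul_le_mul_of_nonneg_left ?_ (norm_nonneg _)
      have him : ((x : ℂ) + y * Complex.I).im = y := by simp
      have hk := norm_integral_sin_div_le hc0 hAX (z := x + y * Complex.I)
        (by rw [him]; intro h0; rw [h0, abs_zero] at hy; linarith)
      rw [him, hy] at hk
      have : Real.pi / (c * d') = h / d' := by rw [hc]; field_simp
      rw [this] at hk
      calc _ ≤ (h / d') / Real.sinh (Real.pi * d' / h) :=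
            div_le_div₀ (by positivity) hk hshpos (hsH x y hy)
        _ = _ := by rw [div_div]
    · apply Continuous.intervalIntegrable
      exact (hFline y hy.le).norm.mul continuous_const
  have hB0 : 0 ≤ B := (norm_nonneg _).trans (hB 0 (by simpa using hd'.le))
  have hVer : ∀ y ∈ Set.Icc (-d') d', ∀ x : ℝ, x = -R ∨ x = R →
      ‖∫ s in A..X, w (x + y * Complex.I) * κ s (x + y * Complex.I)‖ ≤
        B * ((X - A) / (R - Y)) := by
    intro y hy x hx
    rw [intervalIntegral.integral_const_mul, norm_mul]
    refine mul_le_mul ?_ ?_ (norm_nonneg _) hB0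
    · rw [hw]
      simp only
      rw [norm_div]
      refine (div_le_self (norm_nonneg _) (hsV x y hx)).trans (hB _ ?_)
      simpa using abs_le.mpr hy
    · have := intervalIntegral.norm_integral_le_of_norm_le_const (a := A) (b := X)
        (C := (R - Y)⁻¹) (f := fun s => κ s (x + y * Complex.I)) (by
          intro s hs
          rw [Set.uIoc_of_le hAX] at hs
          simp only [hκ]
          rw [norm_mul, Complex.norm_real, norm_inv]
          refine (mul_le_of_le_one_left (by positivity) (Real.abs_sin_le_one _)).trans ?_
          refine inv_anti₀ (by linarith) ?_
          have h1 := Complex.abs_re_le_norm (x + y * Complex.I - s)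
          refine le_trans ?_ h1
          simp only [Complex.sub_re, Complex.add_re, Complex.mul_re, Complex.ofReal_re,
            Complex.ofReal_im, Complex.I_re, Complex.I_im, mul_zero, zero_mul, sub_zero,
            add_zero]
          rcases hx with rfl | rfl
          · rw [abs_sub_comm]
            exact le_trans (by linarith [hs.1]) (le_abs_self _)
          · exact le_trans (by linarith [hs.2]) (le_abs_self _))
      rw [abs_of_nonneg (by linarith)] at this
      rw [div_eq_inv_mul]
      exact this
  have hfin := norm_rectIntegral_le
    (g := fun z => ∫ s in A..X, w z * κ s z) (a := -R) (c := R) (b := -d') (e := d') (by linarith)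
    (hHor (-d') (by rw [abs_neg, abs_of_pos hd'])) (hHor d' (abs_of_pos hd')) hVer
  rw [← hswap, hlhs, norm_mul, norm_mul, norm_mul, Complex.norm_I, Complex.norm_ofNat,
    Complex.norm_real, Real.norm_eq_abs, abs_of_pos Real.pi_pos, mul_one] at hfin
  rw [mul_comm, ← le_div_iff₀ (by positivity)] at hfin
  refine hfin.trans (le_of_eq ?_)
  have : 0 < R - Y := by linarith
  field_simp
  ring

theorem tendsto_sum_Icc_neg {u : ℤ → ℂ} (hu : Summable u) :
    Tendsto (fun n : ℕ => ∑ k ∈ Finset.Icc (-(n : ℤ)) n, u k) atTop (𝓝 (∑' k, u k)) := by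
  refine hu.hasSum.comp ?_
  refine tendsto_atTop_finset_of_monotone ?_ ?_
  · intro m n hmn
    apply Finset.Icc_subset_Icc <;> simp [hmn]
  · intro k
    refine ⟨k.natAbs, ?_⟩
    rw [Finset.mem_Icc]
    omega

theorem norm_integral_error_le {d d' h : ℝ} (hh : 0 < h) (hd' : 0 < d') (hdd : d' < d)
    {F : ℂ → ℂ} (hF : DifferentiableOn ℂ F (strip d)) {B N₁ : ℝ}
    (hB : ∀ z : ℂ, |z.im| ≤ d' → ‖F z‖ ≤ B)
    (hN : ∀ R : ℝ, 0 ≤ R → ∀ y : ℝ, |y| = d' → ∫ x : ℝ in -R..R, ‖F (x + y * Complex.I)‖ ≤ N₁)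
    (hs : Summable fun k : ℤ => ‖F ((k * h : ℝ) : ℂ)‖) {A X : ℝ} (hAX : A ≤ X) :
    ‖(∫ s : ℝ in A..X, F s) - ∑' k : ℤ,
        F ((k * h : ℝ) : ℂ) * ((J k h X - J k h A : ℝ) : ℂ)‖ ≤
      h * N₁ / (Real.pi * d' * Real.sinh (Real.pi * d' / h)) := by
  set Y := max (-A) X with hY
  have hsum : Summable fun k : ℤ => F ((k * h : ℝ) : ℂ) * ((J k h X - J k h A : ℝ) : ℂ) := by
    refine Summable.of_norm_bounded (hs.mul_right (3 * h)) fun k => ?_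
    rw [norm_mul, Complex.norm_real]
    refine mul_le_mul_of_nonneg_left ?_ (norm_nonneg _)
    refine (norm_sub_le _ _).trans ?_
    have h1 := abs_J_le k hh X
    have h2 := abs_J_le k hh A
    rw [Real.norm_eq_abs, Real.norm_eq_abs]
    linarith
  have hR : Tendsto (fun n : ℕ => ((n : ℝ) + 1 / 2) * h) atTop atTop :=
    (tendsto_atTop_add_const_right _ _ tendsto_natCast_atTop_atTop).atTop_mul_const hh
  have hv : Tendsto (fun n : ℕ => h * N₁ / (Real.pi * d' * Real.sinh (Real.pi * d' / h)) +
      B * d' * ((X - A) / (((n : ℝ) + 1 / 2) * h - Y)) * 2 / Real.pi) atTop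
      (𝓝 (h * N₁ / (Real.pi * d' * Real.sinh (Real.pi * d' / h)) + B * d' * 0 * 2 / Real.pi)) := by
    refine Tendsto.const_add _ (((Tendsto.const_mul _ ?_).mul_const _).div_const _)
    exact tendsto_const_nhds.div_atTop (tendsto_atTop_add_const_right _ _ hR)
  have hl := ((tendsto_sum_Icc_neg hsum).const_sub (∫ s : ℝ in A..X, F s)).norm
  have := le_of_tendsto_of_tendsto hl hv (by
    filter_upwards [hR.eventually_gt_atTop Y] with n hn
    exact norm_integral_error_le_finite hh hd' hdd hF hB hN n hAX
      (neg_le.mp (le_max_left _ _)) (le_max_right _ _) hn)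
  simpa using this

/-- The discretization error of the Sinc indefinite integration. -/
theorem norm_improper_integral_error_le {d d' h : ℝ} (hh : 0 < h) (hd' : 0 < d') (hdd : d' < d)
    {F : ℂ → ℂ} (hF : DifferentiableOn ℂ F (strip d)) {B N₁ : ℝ}
    (hB : ∀ z : ℂ, |z.im| ≤ d' → ‖F z‖ ≤ B)
    (hN : ∀ R : ℝ, 0 ≤ R → ∀ y : ℝ, |y| = d' → ∫ x : ℝ in -R..R, ‖F (x + y * Complex.I)‖ ≤ N₁)
    (hs : Summable fun k : ℤ => ‖F ((k * h : ℝ) : ℂ)‖) {X : ℝ} {V : ℂ}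
    (hV : Tendsto (fun A : ℝ => ∫ s : ℝ in A..X, F s) atBot (𝓝 V)) :
    ‖V - ∑' k : ℤ, F ((k * h : ℝ) : ℂ) * (J k h X : ℂ)‖ ≤
      h * N₁ / (Real.pi * d' * Real.sinh (Real.pi * d' / h)) := by
  -- Let `A → -∞`: each `J k h A` tends to 0, and `|J| ≤ 3h/2` gives the domination.
  have ht : Tendsto (fun A : ℝ => ∑' k : ℤ,
      F ((k * h : ℝ) : ℂ) * ((J k h X - J k h A : ℝ) : ℂ)) atBot
      (𝓝 (∑' k : ℤ, F ((k * h : ℝ) : ℂ) * (J k h X : ℂ))) := by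
    refine tendsto_tsum_of_dominated_convergence
      (bound := fun k : ℤ => ‖F ((k * h : ℝ) : ℂ)‖ * (3 * h)) (hs.mul_right _) ?_ ?_
    · intro k
      refine Tendsto.const_mul _ ?_
      have := (tendsto_J_atBot k hh).const_sub (J k h X)
      rw [sub_zero] at this
      exact (Complex.continuous_ofReal.tendsto _).comp this
    · refine Eventually.of_forall fun A k => ?_
      rw [norm_mul, Complex.norm_real]
      refine mul_le_mul_of_nonneg_left ?_ (norm_nonneg _)
      refine (norm_sub_le _ _).trans ?_
      have h1 := abs_J_le k hh X
      have h2 := abs_J_le k hh A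
      rw [Real.norm_eq_abs, Real.norm_eq_abs]
      linarith
  exact le_of_tendsto (hV.sub ht).norm ((eventually_le_atBot X).mono fun A hA =>
    norm_integral_error_le hh hd' hdd hF hB hN hs hA)

/-! ### Lower bound for `|1 + ψ²|` on the strip -/

/-- Follows from `cos a ≤ π/2 - a` and Jordan's inequality `sin a ≥ 2a/π`. It is the second-order
comparison at `x = 0` needed in `sq_sin_mul_cosh_le`. -/
theorem mul_cos_le_mul_sin {a : ℝ} (h0 : 0 ≤ a) (h1 : a ≤ Real.pi / 2) :
    a * Real.cos a ≤ (Real.pi ^ 2 / 4 - a ^ 2) * Real.sin a := by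
  have hc : Real.cos a ≤ Real.pi / 2 - a := by
    rw [← Real.sin_pi_div_two_sub]
    exact Real.sin_le (by linarith)
  have hs := Real.mul_le_sin h0 h1
  have h2 : a * Real.cos a ≤ a * (Real.pi / 2 - a) := mul_le_mul_of_nonneg_left hc h0
  have h3 : 0 ≤ Real.pi ^ 2 / 4 - a ^ 2 := by nlinarith
  have h4 : (Real.pi ^ 2 / 4 - a ^ 2) * (2 / Real.pi * a) ≤
      (Real.pi ^ 2 / 4 - a ^ 2) * Real.sin a := mul_le_mul_of_nonneg_left hs h3
  have h5 : (Real.pi ^ 2 / 4 - a ^ 2) * (2 / Real.pi * a) =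
      a * (Real.pi / 2 - a) + 2 / Real.pi * (a ^ 2 * (Real.pi / 2 - a)) := by
    field_simp
    ring
  have h6 : 0 ≤ 2 / Real.pi * (a ^ 2 * (Real.pi / 2 - a)) := by
    have : 0 ≤ Real.pi / 2 - a := by linarith
    positivity
  linarith

theorem one_add_sq_div_two_le_cosh (t : ℝ) : 1 + t ^ 2 / 2 ≤ Real.cosh t := by
  have h1 : Real.cosh t = 1 + 2 * Real.sinh (t / 2) ^ 2 := by
    have := Real.cosh_two_mul (t / 2)
    rw [show 2 * (t / 2) = t by ring] at this
    rw [this, Real.cosh_sq]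
    ring
  have h2 : (t / 2) ^ 2 ≤ Real.sinh (t / 2) ^ 2 := by
    rw [sq_le_sq, Real.abs_sinh]
    exact (Real.self_le_sinh_iff.mpr (abs_nonneg _))
  rw [h1]
  nlinarith

/-- For `a ≥ 0` put `t = a (cosh x - 1)`. Then `|sin (a + t)| ≤ sin a + t cos a`, while `cosh (b
sinh x) ≥ 1 + b² sinh² x / 2 ≥ 1 + b² (cosh x - 1)`. What remains is `a cos a ≤ b² sin a`. -/
theorem sq_sin_mul_cosh_le {a b : ℝ} (ha : |a| ≤ Real.pi / 2) (hb : a ^ 2 + b ^ 2 = Real.pi ^ 2 / 4)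
    (x : ℝ) :
    Real.sin (a * Real.cosh x) ^ 2 ≤ (Real.cosh (b * Real.sinh x) * Real.sin a) ^ 2 := by
  wlog h0 : 0 ≤ a generalizing a
  · have := this (a := -a) (by rwa [abs_neg]) (by linarith) (by linarith)
    rw [neg_mul, Real.sin_neg, Real.sin_neg] at this
    nlinarith
  rw [abs_of_nonneg h0] at ha
  have hs : 0 ≤ Real.sin a := Real.sin_nonneg_of_nonneg_of_le_pi h0 (by linarith [Real.pi_pos])
  have hc : 0 ≤ Real.cos a := Real.cos_nonneg_of_neg_pi_div_two_le_of_le (by linarith) ha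
  have hC := Real.one_le_cosh x
  set t := a * (Real.cosh x - 1) with ht
  have ht0 : 0 ≤ t := mul_nonneg h0 (by linarith)
  have e1 : a * Real.cosh x = a + t := by rw [ht]; ring
  have hsin : |Real.sin (a * Real.cosh x)| ≤ Real.sin a + Real.cos a * t := by
    rw [e1, Real.sin_add]
    refine (abs_add_le _ _).trans (add_le_add ?_ ?_)
    · rw [abs_mul, abs_of_nonneg hs]
      exact mul_le_of_le_one_right hs (Real.abs_cos_le_one _)
    · rw [abs_mul, abs_of_nonneg hc]
      refine mul_le_mul_of_nonneg_left ?_ hc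
      exact Real.abs_sin_le_abs.trans_eq (abs_of_nonneg ht0)
  have hmain : Real.sin a + Real.cos a * t ≤ Real.cosh (b * Real.sinh x) * Real.sin a := by
    have h1 := mul_cos_le_mul_sin h0 ha
    have h2 := one_add_sq_div_two_le_cosh (b * Real.sinh x)
    have h3 : Real.sinh x ^ 2 = Real.cosh x ^ 2 - 1 := Real.sinh_sq x
    have h4 : Real.cos a * t ≤ b ^ 2 * Real.sin a * (Real.cosh x - 1) := by
      have : Real.cos a * t = a * Real.cos a * (Real.cosh x - 1) := by rw [ht]; ring
      rw [this]
      refine mul_le_mul_of_nonneg_right ?_ (by linarith)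
      rwa [show b ^ 2 = Real.pi ^ 2 / 4 - a ^ 2 by linarith]
    have h5 : b ^ 2 * (Real.cosh x - 1) ≤ (b * Real.sinh x) ^ 2 / 2 := by
      rw [mul_pow, h3]
      nlinarith [mul_nonneg (sq_nonneg b) (sq_nonneg (Real.cosh x - 1))]
    nlinarith
  rw [sq_le_sq, abs_of_nonneg (mul_nonneg (Real.cosh_pos _).le hs)]
  exact hsin.trans hmain

theorem hasDerivAt_deMap (ζ : ℂ) :
    HasDerivAt deMap (deMap ζ * (Real.pi / 2 * Complex.cosh ζ)) ζ :=
  ((Complex.hasDerivAt_sinh ζ).const_mul _).cexp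

theorem norm_deMap (ζ : ℂ) :
    ‖deMap ζ‖ = Real.exp (Real.pi * Real.sinh ζ.re * Real.cos ζ.im / 2) := by
  rw [deMap, Complex.norm_exp]
  congr 1
  conv_lhs => rw [← Complex.re_add_im ζ, Complex.sinh_add, Complex.cosh_mul_I, Complex.sinh_mul_I]
  rw [← Complex.ofReal_sinh, ← Complex.ofReal_cosh, ← Complex.ofReal_sin, ← Complex.ofReal_cos]
  simp [-Complex.ofReal_sinh, -Complex.ofReal_cosh, -Complex.ofReal_sin, -Complex.ofReal_cos]
  ring

theorem deMap_sq (ζ : ℂ) : deMap ζ ^ 2 =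
    Complex.exp ((Real.pi * Real.sinh ζ.re * Real.cos ζ.im : ℝ) +
      (2 * (Real.pi / 2 * Real.sin ζ.im * Real.cosh ζ.re) : ℝ) * Complex.I) := by
  rw [deMap, ← Complex.exp_nat_mul]
  congr 1
  conv_lhs => rw [← Complex.re_add_im ζ, Complex.sinh_add, Complex.cosh_mul_I, Complex.sinh_mul_I]
  push_cast
  ring

/-- Write `ψ² = e^{u + 2iv}`. Then `|1 + ψ²|² = 4 e^u (cosh²(u/2) - sin² v)` and `(1 + e^u)² = 4 e^u
cosh²(u/2)`. Here `v = a cosh x` and `u/2 = b sinh x` with `a² + b² = π²/4`, so `sq_sin_mul_cosh_le`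
applies. -/
theorem one_add_exp_mul_cos_le (ζ : ℂ) :
    (1 + Real.exp (Real.pi * Real.sinh ζ.re * Real.cos ζ.im)) *
      Real.cos (Real.pi / 2 * Real.sin ζ.im) ≤ ‖1 + deMap ζ ^ 2‖ := by
  set u := Real.pi * Real.sinh ζ.re * Real.cos ζ.im with hu
  set a := Real.pi / 2 * Real.sin ζ.im with ha
  set v := a * Real.cosh ζ.re with hv
  have hnorm : ‖1 + deMap ζ ^ 2‖ ^ 2 = (1 + Real.exp u) ^ 2 - 4 * Real.exp u * Real.sin v ^ 2 := by
    rw [deMap_sq, Complex.exp_add_mul_I, Complex.sq_norm, ← Complex.ofReal_exp,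
      ← Complex.ofReal_cos, ← Complex.ofReal_sin]
    have : (1 + (Real.exp u : ℂ) * ((Real.cos (2 * v) : ℂ) + (Real.sin (2 * v) : ℂ) * Complex.I)) =
        ((1 + Real.exp u * Real.cos (2 * v) : ℝ) : ℂ) +
          ((Real.exp u * Real.sin (2 * v) : ℝ) : ℂ) * Complex.I := by
      push_cast; ring
    rw [this, Complex.normSq_add_mul_I]
    have h1 := Real.sin_sq_add_cos_sq (2 * v)
    have h2 : Real.cos (2 * v) = 1 - 2 * Real.sin v ^ 2 := by
      rw [Real.cos_two_mul, Real.cos_sq']; ring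
    have h3 : Real.sin (2 * v) ^ 2 = 1 - Real.cos (2 * v) ^ 2 := by linarith
    rw [mul_pow, h3, h2]
    ring
  have hcosh : (1 + Real.exp u) ^ 2 = 4 * Real.exp u * Real.cosh (u / 2) ^ 2 := by
    rw [Real.cosh_eq]
    have h1 : Real.exp u = Real.exp (u / 2) ^ 2 := by rw [← Real.exp_nat_mul]; congr 1; push_cast; ring
    rw [h1, Real.exp_neg]
    field_simp
    ring
  have hsin := sq_sin_mul_cosh_le (a := a) (b := Real.pi / 2 * Real.cos ζ.im)
    (by
      rw [ha, abs_mul, abs_of_pos (by positivity)]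
      exact mul_le_of_le_one_right (by positivity) (Real.abs_sin_le_one _))
    (by rw [ha]; linear_combination Real.pi ^ 2 / 4 * Real.sin_sq_add_cos_sq ζ.im) ζ.re
  rw [show Real.pi / 2 * Real.cos ζ.im * Real.sinh ζ.re = u / 2 by rw [hu]; ring, ← hv] at hsin
  refine (le_abs_self _).trans (abs_le_of_sq_le_sq ?_ (norm_nonneg _))
  rw [hnorm, mul_pow, Real.cos_sq', mul_sub, mul_one]
  have h4 : 4 * Real.exp u * Real.sin v ^ 2 ≤
      4 * Real.exp u * (Real.cosh (u / 2) * Real.sin a) ^ 2 :=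
    mul_le_mul_of_nonneg_left hsin (by positivity)
  rw [hcosh]
  nlinarith

/-! ### Decay of the transformed integrand -/

theorem norm_cosh_le (ζ : ℂ) : ‖Complex.cosh ζ‖ ≤ Real.cosh ζ.re := by
  rw [Complex.cosh, Real.cosh_eq, norm_div, Complex.norm_ofNat]
  refine div_le_div_of_nonneg_right ((norm_add_le _ _).trans_eq ?_) (by norm_num)
  rw [Complex.norm_exp, Complex.norm_exp, Complex.neg_re]

theorem cos_pi_div_two_mul_sin_pos {y : ℝ} (h : |y| < Real.pi / 2) :
    0 < Real.cos (Real.pi / 2 * Real.sin y) := by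
  rw [abs_lt] at h
  apply Real.cos_pos_of_mem_Ioo
  have h1 : |Real.sin y| < 1 := by
    have hc := Real.cos_pos_of_mem_Ioo h
    rw [← sq_lt_one_iff_abs_lt_one]
    nlinarith [Real.sin_sq_add_cos_sq y]
  rw [abs_lt] at h1
  constructor <;> nlinarith [Real.pi_pos, h1.1, h1.2]

/-- Up to constants and `cosh`, the integrand is `e^{uα/2} / (1 + e^u)^{(α+β)/2}`. Dropping the 1 in
the denominator gives the rate `β` of the right end, dropping `e^u` the rate `α` of the left end;
the disjunction on `s` covers both. -/
theorem norm_comp_deMap_le {d : ℝ} (hd' : d < Real.pi / 2) {f : ℂ → ℂ} {K α β : ℝ} (hK : 0 < K)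
    (hα : 0 < α) (hβ : 0 < β)
    (hbound : ∀ z ∈ deMap '' strip d, ‖f z‖ ≤ K * ‖E₂ z α β‖) {ζ : ℂ} (hζ : ζ ∈ strip d)
    {s : ℝ} (hs : s ≤ Real.pi * Real.sinh ζ.re * Real.cos ζ.im * β / 2 ∨
      s ≤ -(Real.pi * Real.sinh ζ.re * Real.cos ζ.im * α / 2)) :
    ‖f (deMap ζ) * deriv deMap ζ‖ ≤ K * (Real.pi / 2) /
      Real.cos (Real.pi / 2 * Real.sin ζ.im) ^ ((α + β) / 2) *
        (Real.cosh ζ.re * Real.exp (-s)) := by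
  set u := Real.pi * Real.sinh ζ.re * Real.cos ζ.im with hu
  set a := Real.pi / 2 * Real.sin ζ.im with ha
  have hca : 0 < Real.cos a := cos_pi_div_two_mul_sin_pos (lt_trans hζ hd')
  have hlow := one_add_exp_mul_cos_le ζ
  rw [← hu, ← ha] at hlow
  have hp : 0 ≤ (α + β) / 2 := by positivity
  have hE : ‖E₂ (deMap ζ) α β‖ ≤ ‖deMap ζ‖ ^ (α - 1) /
      ((1 + Real.exp u) ^ ((α + β) / 2) * Real.cos a ^ ((α + β) / 2)) := by
    rw [E₂, norm_div, Complex.norm_cpow_real, Complex.norm_cpow_real,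
      ← Real.mul_rpow (by positivity) hca.le]
    refine div_le_div_of_nonneg_left (by positivity) (by positivity) ?_
    exact Real.rpow_le_rpow (by positivity) hlow hp
  have hψ : ‖deMap ζ‖ ^ (α - 1) * ‖deMap ζ‖ = Real.exp (u * α / 2) := by
    have h0 : 0 < ‖deMap ζ‖ := by rw [norm_deMap]; positivity
    rw [← Real.rpow_add_one h0.ne', sub_add_cancel, norm_deMap, ← Real.exp_mul, ← hu]
    ring_nf
  have hexp : Real.exp (u * α / 2) / (1 + Real.exp u) ^ ((α + β) / 2) ≤ Real.exp (-s) := by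
    rw [div_le_iff₀ (by positivity)]
    rcases hs with hs | hs
    · have h1 : Real.exp u ^ ((α + β) / 2) ≤ (1 + Real.exp u) ^ ((α + β) / 2) :=
        Real.rpow_le_rpow (by positivity) (by linarith) hp
      rw [← Real.exp_mul] at h1
      refine le_trans ?_ (mul_le_mul_of_nonneg_left h1 (Real.exp_pos _).le)
      rw [← Real.exp_add]
      apply Real.exp_le_exp.mpr
      linarith
    · have h1 : 1 ≤ (1 + Real.exp u) ^ ((α + β) / 2) :=
        Real.one_le_rpow (by linarith [Real.exp_pos u]) hp
      refine le_trans ?_ (le_mul_of_one_le_right (Real.exp_pos _).le h1)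
      apply Real.exp_le_exp.mpr
      linarith
  rw [(hasDerivAt_deMap ζ).deriv, norm_mul, norm_mul, norm_mul]
  have hπ : ‖(Real.pi / 2 : ℂ)‖ = Real.pi / 2 := by
    rw [norm_div, Complex.norm_real, Complex.norm_ofNat, Real.norm_of_nonneg Real.pi_pos.le]
  rw [hπ]
  calc ‖f (deMap ζ)‖ * (‖deMap ζ‖ * (Real.pi / 2 * ‖Complex.cosh ζ‖))
      ≤ (K * (‖deMap ζ‖ ^ (α - 1) /
          ((1 + Real.exp u) ^ ((α + β) / 2) * Real.cos a ^ ((α + β) / 2)))) *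
          (‖deMap ζ‖ * (Real.pi / 2 * Real.cosh ζ.re)) := by
        have h1 := (hbound _ ⟨ζ, hζ, rfl⟩).trans (mul_le_mul_of_nonneg_left hE hK.le)
        have h2 := norm_cosh_le ζ
        gcongr
    _ = K * (Real.pi / 2) / Real.cos a ^ ((α + β) / 2) * (Real.cosh ζ.re *
          ((‖deMap ζ‖ ^ (α - 1) * ‖deMap ζ‖) / (1 + Real.exp u) ^ ((α + β) / 2))) := by
        have : 0 < Real.cos a ^ ((α + β) / 2) := by positivity
        have : 0 < (1 + Real.exp u) ^ ((α + β) / 2) := by positivity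
        field_simp
    _ ≤ _ := by
        rw [hψ]
        refine mul_le_mul_of_nonneg_left ?_ (by positivity)
        exact mul_le_mul_of_nonneg_left hexp (Real.cosh_pos _).le

theorem cos_pi_div_two_mul_sin_anti {y d : ℝ} (hd : d < Real.pi / 2) (h : |y| ≤ d) :
    Real.cos (Real.pi / 2 * Real.sin d) ≤ Real.cos (Real.pi / 2 * Real.sin y) := by
  have h0 : 0 ≤ |y| := abs_nonneg y
  have hy : Real.cos (Real.pi / 2 * Real.sin y) = Real.cos (Real.pi / 2 * Real.sin |y|) := by
    rcases abs_choice y with h | h <;> simp [h]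
  rw [hy]
  have h2 : Real.sin |y| ≤ Real.sin d :=
    Real.sin_le_sin_of_le_of_le_pi_div_two (by linarith [Real.pi_pos]) hd.le h
  have h3 : 0 ≤ Real.sin |y| := Real.sin_nonneg_of_nonneg_of_le_pi h0 (by linarith [Real.pi_pos])
  apply Real.cos_le_cos_of_nonneg_of_le_pi (by positivity)
  · nlinarith [Real.sin_le_one d, Real.pi_pos]
  · exact mul_le_mul_of_nonneg_left h2 (by positivity)

theorem norm_comp_deMap_le_exp_abs {d d' : ℝ} (hdd : d' < d) (hd : d < Real.pi / 2) {f : ℂ → ℂ}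
    {K α β : ℝ} (hK : 0 < K) (hα : 0 < α) (hβ : 0 < β)
    (hbound : ∀ z ∈ deMap '' strip d, ‖f z‖ ≤ K * ‖E₂ z α β‖) {ζ : ℂ} (hζ : |ζ.im| ≤ d') :
    ‖f (deMap ζ) * deriv deMap ζ‖ ≤ K * (Real.pi / 2) /
      Real.cos (Real.pi / 2 * Real.sin d') ^ ((α + β) / 2) *
        (Real.cosh ζ.re *
          Real.exp (-(Real.pi * min α β / 2 * Real.cos d' * |Real.sinh ζ.re|))) := by
  have hd0 : 0 ≤ d' := (abs_nonneg _).trans hζ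
  have hcos : Real.cos d' ≤ Real.cos ζ.im := by
    rw [← Real.cos_abs ζ.im]
    exact Real.cos_le_cos_of_nonneg_of_le_pi (abs_nonneg _) (by linarith [Real.pi_pos]) hζ
  have hcd : 0 < Real.cos d' := Real.cos_pos_of_mem_Ioo ⟨by linarith [Real.pi_pos], by linarith⟩
  have hmin : 0 < min α β := lt_min hα hβ
  have key : ∀ γ, min α β ≤ γ → Real.pi * min α β / 2 * Real.cos d' * |Real.sinh ζ.re| ≤
      Real.pi * |Real.sinh ζ.re| * Real.cos ζ.im * γ / 2 := by
    intro γ hγ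
    have h1 : min α β * Real.cos d' ≤ γ * Real.cos ζ.im :=
      mul_le_mul hγ hcos hcd.le (hmin.le.trans hγ)
    have h2 := mul_le_mul_of_nonneg_left h1
      (show 0 ≤ Real.pi / 2 * |Real.sinh ζ.re| by positivity)
    linarith
  refine (norm_comp_deMap_le hd hK hα hβ hbound (lt_of_le_of_lt hζ hdd)
    (s := Real.pi * min α β / 2 * Real.cos d' * |Real.sinh ζ.re|) ?_).trans ?_
  · rcases le_total 0 (Real.sinh ζ.re) with h0 | h0
    · left
      have := key β (min_le_right _ _)
      rwa [abs_of_nonneg h0] at this ⊢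
    · right
      have := key α (min_le_left _ _)
      rw [abs_of_nonpos h0] at this ⊢
      linarith
  · refine mul_le_mul_of_nonneg_right ?_ (by positivity)
    have hc0 := cos_pi_div_two_mul_sin_pos (y := d') (by rw [abs_of_nonneg hd0]; linarith)
    refine div_le_div_of_nonneg_left (by positivity) (by positivity) ?_
    exact Real.rpow_le_rpow hc0.le (cos_pi_div_two_mul_sin_anti (by linarith) hζ) (by positivity)

theorem hasDerivAt_exp_neg_mul_sinh {q : ℝ} (hq : q ≠ 0) (x : ℝ) :
    HasDerivAt (fun x => -(Real.exp (-(q * Real.sinh x)) / q))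
      (Real.cosh x * Real.exp (-(q * Real.sinh x))) x := by
  have h1 : HasDerivAt (fun x : ℝ => -(q * Real.sinh x)) (-(q * Real.cosh x)) x :=
    ((Real.hasDerivAt_sinh x).const_mul q).neg
  convert! (h1.exp.div_const q).neg using 1
  field_simp

theorem integral_cosh_mul_exp_le {q : ℝ} (hq : 0 < q) {R : ℝ} (hR : 0 ≤ R) :
    ∫ x in -R..R, Real.cosh x * Real.exp (-(q * |Real.sinh x|)) ≤ 2 / q := by
  have hc : Continuous fun x => Real.cosh x * Real.exp (-(q * |Real.sinh x|)) := by
    have := Real.continuous_sinh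
    have := Real.continuous_cosh
    fun_prop
  have hpos : ∫ x in (0 : ℝ)..R, Real.cosh x * Real.exp (-(q * |Real.sinh x|)) ≤ 1 / q := by
    have h1 : ∫ x in (0 : ℝ)..R, Real.cosh x * Real.exp (-(q * |Real.sinh x|)) =
        ∫ x in (0 : ℝ)..R, Real.cosh x * Real.exp (-(q * Real.sinh x)) := by
      refine intervalIntegral.integral_congr fun x hx => ?_
      rw [Set.uIcc_of_le hR] at hx
      rw [abs_of_nonneg (Real.sinh_nonneg_iff.mpr hx.1)]
    rw [h1, intervalIntegral.integral_eq_sub_of_hasDerivAt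
      (fun x _ => hasDerivAt_exp_neg_mul_sinh hq.ne' x)]
    · have : 0 ≤ Real.exp (-(q * Real.sinh R)) / q := by positivity
      simp only [Real.sinh_zero, mul_zero, neg_zero, Real.exp_zero]
      linarith
    · apply Continuous.intervalIntegrable
      have := Real.continuous_sinh
      have := Real.continuous_cosh
      fun_prop
  have hneg : ∫ x in -R..0, Real.cosh x * Real.exp (-(q * |Real.sinh x|)) =
      ∫ x in (0 : ℝ)..R, Real.cosh x * Real.exp (-(q * |Real.sinh x|)) := by
    have := intervalIntegral.integral_comp_neg (a := 0) (b := R)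
      (fun x => Real.cosh x * Real.exp (-(q * |Real.sinh x|)))
    simp only [Real.cosh_neg, Real.sinh_neg, abs_neg, neg_zero] at this
    exact this.symm
  rw [← intervalIntegral.integral_add_adjacent_intervals (hc.intervalIntegrable (-R) 0)
    (hc.intervalIntegrable 0 R), hneg]
  have : 2 / q = 1 / q + 1 / q := by ring
  linarith

theorem cosh_le_one_add_abs_sinh (x : ℝ) : Real.cosh x ≤ 1 + |Real.sinh x| := by
  refine (le_abs_self _).trans (abs_le_of_sq_le_sq ?_ (by positivity))
  nlinarith [Real.cosh_sq x, sq_abs (Real.sinh x), abs_nonneg (Real.sinh x)]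

theorem cosh_mul_exp_le {q : ℝ} (hq : 0 < q) (x : ℝ) :
    Real.cosh x * Real.exp (-(q * |Real.sinh x|)) ≤ 1 + 1 / q := by
  set t := |Real.sinh x| with ht
  have h0 : 0 ≤ t := abs_nonneg _
  have h1 := cosh_le_one_add_abs_sinh x
  rw [Real.exp_neg, ← div_eq_mul_inv, div_le_iff₀ (Real.exp_pos _)]
  have h2 := Real.add_one_le_exp (q * t)
  have h3 : (1 + 1 / q) * (q * t + 1) ≤ (1 + 1 / q) * Real.exp (q * t) :=
    mul_le_mul_of_nonneg_left h2 (by positivity)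
  have h4 : (1 + 1 / q) * (q * t + 1) = 1 + t + q * t + 1 / q := by field_simp; ring
  have : 0 ≤ q * t + 1 / q := by positivity
  linarith

/-- Half of the exponent absorbs `cosh`; the other half is dominated by a geometric series, since
`|sinh (kh)| ≥ |k| h`. -/
theorem summable_cosh_mul_exp {q h : ℝ} (hq : 0 < q) (hh : 0 < h) :
    Summable fun k : ℤ => Real.cosh (k * h) * Real.exp (-(q * |Real.sinh (k * h)|)) := by
  have hgeom : Summable fun k : ℤ => Real.exp (-(q / 2 * h * |(k : ℝ)|)) := by
    have hn : Summable fun n : ℕ => Real.exp (n * (-(q / 2 * h))) :=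
      Real.summable_exp_nat_mul_iff.mpr (by have : 0 < q / 2 * h := by positivity
                                            linarith)
    refine Summable.of_nat_of_neg (hn.congr fun n => ?_) (hn.congr fun n => ?_)
    · rw [Int.cast_natCast, abs_of_nonneg (by positivity)]; ring_nf
    · rw [Int.cast_neg, Int.cast_natCast, abs_neg, abs_of_nonneg (by positivity)]; ring_nf
  refine Summable.of_nonneg_of_le (fun k => by positivity) (fun k => ?_)
    (hgeom.mul_left (1 + 1 / (q / 2)))
  have h1 := cosh_mul_exp_le (half_pos hq) (k * h)
  have h2 : q / 2 * h * |(k : ℝ)| ≤ q / 2 * |Real.sinh (k * h)| := by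
    rw [mul_assoc]
    refine mul_le_mul_of_nonneg_left ?_ (by positivity)
    have h3 : h * |(k : ℝ)| = |k * h| := by rw [abs_mul, abs_of_pos hh, mul_comm]
    rw [h3, Real.abs_sinh]
    exact Real.self_le_sinh_iff.mpr (abs_nonneg _)
  have h4 : Real.cosh (k * h) * Real.exp (-(q * |Real.sinh (k * h)|)) =
      Real.cosh (k * h) * Real.exp (-(q / 2 * |Real.sinh (k * h)|)) *
        Real.exp (-(q / 2 * |Real.sinh (k * h)|)) := by
    rw [mul_assoc, ← Real.exp_add]; ring_nf
  rw [h4]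
  refine mul_le_mul h1 (Real.exp_le_exp.mpr (by linarith)) (by positivity) (by positivity)

/-! ### Change of variables and the double-exponential discretization error -/

theorem deMap_ofReal (x : ℝ) : deMap x = (Real.exp (Real.pi / 2 * Real.sinh x) : ℝ) := by
  simp [deMap]

theorem deriv_deMap_ofReal (x : ℝ) : deriv deMap x =
    (Real.exp (Real.pi / 2 * Real.sinh x) * (Real.pi / 2 * Real.cosh x) : ℝ) := by
  rw [(hasDerivAt_deMap x).deriv, deMap_ofReal]
  push_cast
  ring

theorem ofReal_mem_strip {d : ℝ} (hd : 0 < d) (x : ℝ) : (x : ℂ) ∈ strip d := by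
  simpa [strip] using hd

theorem ofReal_mem_image {d : ℝ} (hd : 0 < d) {t : ℝ} (ht : 0 < t) :
    (t : ℂ) ∈ deMap '' strip d :=
  ⟨deInv t, ofReal_mem_strip hd _, deMap_deInv ht⟩

theorem differentiableOn_comp_deMap {d : ℝ} {f : ℂ → ℂ}
    (hf : AnalyticOnNhd ℂ f (deMap '' strip d)) :
    DifferentiableOn ℂ (fun ζ => f (deMap ζ) * deriv deMap ζ) (strip d) := by
  intro ζ hζ
  have h1 : DifferentiableAt ℂ (fun ζ => f (deMap ζ)) ζ :=
    (hf _ ⟨ζ, hζ, rfl⟩).differentiableAt.comp ζ (hasDerivAt_deMap ζ).differentiableAt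
  have h2 : deriv deMap = fun ζ => deMap ζ * (Real.pi / 2 * Complex.cosh ζ) :=
    funext fun ζ => (hasDerivAt_deMap ζ).deriv
  rw [h2]
  exact (h1.mul ((hasDerivAt_deMap ζ).differentiableAt.mul
    (Complex.differentiable_cosh.differentiableAt.const_mul _))).differentiableWithinAt

theorem continuousOn_ofReal_Ioi {d : ℝ} (hd : 0 < d) {f : ℂ → ℂ}
    (hf : AnalyticOnNhd ℂ f (deMap '' strip d)) :
    ContinuousOn (fun t : ℝ => f t) (Set.Ioi 0) :=
  hf.continuousOn.comp Complex.continuous_ofReal.continuousOn fun _ ht => ofReal_mem_image hd ht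

/-- For real `t > 0` the denominator of `E₂` is at least 1, so `K t^(α-1)` dominates, and `α > 0`.
-/
theorem intervalIntegrable_zero {d : ℝ} (hd : 0 < d) {f : ℂ → ℂ}
    (hf : AnalyticOnNhd ℂ f (deMap '' strip d)) {K α β : ℝ} (hK : 0 < K) (hα : 0 < α) (hβ : 0 < β)
    (hbound : ∀ z ∈ deMap '' strip d, ‖f z‖ ≤ K * ‖E₂ z α β‖) {τ : ℝ} (hτ : 0 < τ) :
    IntervalIntegrable (fun t : ℝ => f t) volume 0 τ := by
  have hr : IntervalIntegrable (fun t : ℝ => K * t ^ (α - 1)) volume 0 τ :=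
    (intervalIntegral.intervalIntegrable_rpow' (by linarith)).const_mul K
  refine hr.mono_fun' ?_ ?_
  · rw [Set.uIoc_of_le hτ.le]
    exact ((continuousOn_ofReal_Ioi hd hf).mono fun t ht => ht.1).aestronglyMeasurable
      measurableSet_Ioc
  · rw [Set.uIoc_of_le hτ.le]
    filter_upwards [ae_restrict_mem measurableSet_Ioc] with t ht
    refine (hbound _ (ofReal_mem_image hd ht.1)).trans (mul_le_mul_of_nonneg_left ?_ hK.le)
    rw [E₂, norm_div, Complex.norm_cpow_real, Complex.norm_cpow_real, Complex.norm_real,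
      Real.norm_of_nonneg ht.1.le]
    refine div_le_self (Real.rpow_nonneg ht.1.le _) (Real.one_le_rpow ?_ (by positivity))
    have : (1 + (t : ℂ) ^ 2) = ((1 + t ^ 2 : ℝ) : ℂ) := by push_cast; ring
    rw [this, Complex.norm_real, Real.norm_of_nonneg (by positivity)]
    nlinarith [sq_nonneg t]

theorem tendsto_sinh_atBot : Tendsto Real.sinh atBot atBot := by
  refine tendsto_atBot_mono' _ ?_ tendsto_id
  filter_upwards [eventually_le_atBot 0] with x hx
  exact Real.sinh_le_self_iff.mpr hx

/-- Substitution on `[A, ψ⁻¹(τ)]`, where `f` is continuous, followed by continuity at 0 of the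
primitive, as `ψ(A) → 0⁺`. -/
theorem tendsto_integral_comp_deMap {d : ℝ} (hd : 0 < d) {f : ℂ → ℂ}
    (hf : AnalyticOnNhd ℂ f (deMap '' strip d)) {τ : ℝ} (hτ : 0 < τ)
    (hint : IntervalIntegrable (fun t : ℝ => f t) volume 0 τ) :
    Tendsto (fun A : ℝ => ∫ s : ℝ in A..deInv τ, f (deMap s) * deriv deMap s) atBot
      (𝓝 (∫ t in (0 : ℝ)..τ, f t)) := by
  set φ : ℝ → ℝ := fun x => Real.exp (Real.pi / 2 * Real.sinh x) with hφ
  have hφτ : φ (deInv τ) = τ := by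
    have := deMap_deInv hτ
    rw [deMap_ofReal] at this
    exact Complex.ofReal_injective this
  have hcv : ∀ A, ∫ s : ℝ in A..deInv τ, f (deMap s) * deriv deMap s =
      ∫ t in φ A..τ, f t := by
    intro A
    have hd1 : ∀ x ∈ Set.uIcc A (deInv τ), HasDerivAt φ (φ x * (Real.pi / 2 * Real.cosh x)) x :=
      fun x _ => ((Real.hasDerivAt_sinh x).const_mul _).exp
    have := intervalIntegral.integral_deriv_smul_comp' (g := fun t : ℝ => f t) hd1
      (by
        have := Real.continuous_sinh
        have := Real.continuous_cosh
        apply Continuous.continuousOn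
        rw [hφ]
        fun_prop)
      ((continuousOn_ofReal_Ioi hd hf).mono (by
        rintro _ ⟨x, -, rfl⟩
        exact Real.exp_pos _))
    rw [hφτ] at this
    rw [← this]
    refine intervalIntegral.integral_congr fun s _ => ?_
    simp only [Function.comp_apply]
    rw [deMap_ofReal, deriv_deMap_ofReal, Complex.real_smul, mul_comm]
  have hφ0 : Tendsto φ atBot (𝓝[>] 0) := by
    refine tendsto_nhdsWithin_iff.mpr ⟨?_, Eventually.of_forall fun x => Real.exp_pos _⟩
    exact Real.tendsto_exp_atBot.comp (tendsto_sinh_atBot.const_mul_atBot (by positivity))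
  have hcont := intervalIntegral.continuousOn_primitive_interval' hint
    (Set.right_mem_uIcc (a := 0) (b := τ))
  have h0 : Tendsto (fun u => ∫ t in τ..u, f (t : ℝ)) (𝓝[Set.uIcc 0 τ] 0)
      (𝓝 (∫ t in τ..(0 : ℝ), f t)) := hcont 0 Set.left_mem_uIcc
  have hφ1 : Tendsto φ atBot (𝓝[Set.uIcc 0 τ] 0) := by
    refine tendsto_nhdsWithin_iff.mpr ⟨hφ0.mono_right nhdsWithin_le_nhds, ?_⟩
    have h1 : ∀ᶠ x in atBot, φ x < τ :=
      (hφ0.mono_right nhdsWithin_le_nhds).eventually_lt_const hτ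
    filter_upwards [h1] with x hx
    rw [Set.uIcc_of_le hτ.le]
    exact ⟨(Real.exp_pos _).le, hx.le⟩
  have := (h0.comp hφ1).neg
  rw [intervalIntegral.integral_symm 0 τ, neg_neg] at this
  refine this.congr fun A => ?_
  rw [hcv, Function.comp_apply, intervalIntegral.integral_symm, neg_neg]

theorem summable_norm_comp_deMap {d : ℝ} (hd : 0 < d) (hd' : d < Real.pi / 2) {f : ℂ → ℂ}
    {K α β : ℝ} (hK : 0 < K) (hα : 0 < α) (hβ : 0 < β)
    (hbound : ∀ z ∈ deMap '' strip d, ‖f z‖ ≤ K * ‖E₂ z α β‖) {h : ℝ} (hh : 0 < h) :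
    Summable fun k : ℤ => ‖f (deMap ((k * h : ℝ) : ℂ)) * deriv deMap ((k * h : ℝ) : ℂ)‖ := by
  have hmin : 0 < min α β := lt_min hα hβ
  refine Summable.of_nonneg_of_le (fun k => norm_nonneg _) (fun k => ?_)
    ((summable_cosh_mul_exp (q := Real.pi * min α β / 2) (by positivity) hh).mul_left
      (K * (Real.pi / 2)))
  have := norm_comp_deMap_le_exp_abs hd hd' hK hα hβ hbound (ζ := ((k * h : ℝ) : ℂ)) (d' := 0)
    (by simp)
  simpa using this

/-- The discretization error of the double-exponential Sinc indefinite integration. -/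
theorem norm_discretization_error_le {d : ℝ} (hd : 0 < d) (hd' : d < Real.pi / 2) {f : ℂ → ℂ}
    (hf : AnalyticOnNhd ℂ f (deMap '' strip d)) {K α β : ℝ} (hK : 0 < K) (hα : 0 < α) (hβ : 0 < β)
    (hbound : ∀ z ∈ deMap '' strip d, ‖f z‖ ≤ K * ‖E₂ z α β‖) {h : ℝ} (hh : 0 < h)
    {τ : ℝ} (hτ : 0 < τ) :
    ‖(∫ t in (0 : ℝ)..τ, f t) - ∑' k : ℤ, f (deMap ((k * h : ℝ) : ℂ)) *
        deriv deMap ((k * h : ℝ) : ℂ) * (J k h (deInv τ) : ℂ)‖ ≤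
      h * (2 * K / (min α β * Real.cos (Real.pi / 2 * Real.sin d) ^ ((α + β) / 2) * Real.cos d)) /
        (Real.pi * d * Real.sinh (Real.pi * d / h)) := by
  have hmin : 0 < min α β := lt_min hα hβ
  have hcd : 0 < Real.cos d := Real.cos_pos_of_mem_Ioo ⟨by linarith, hd'⟩
  have hCd := cos_pi_div_two_mul_sin_pos (y := d) (by rwa [abs_of_pos hd])
  have hsd : 0 < Real.sinh (Real.pi * d / h) := Real.sinh_pos_iff.mpr (by positivity)
  -- Nothing is known on the boundary of the open strip, so the bound is proved with the contour at
  -- height `e < d`; it is continuous in `e` at `d`.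
  have hlim : Tendsto (fun e : ℝ =>
      h * (2 * K / (min α β * Real.cos (Real.pi / 2 * Real.sin e) ^ ((α + β) / 2) * Real.cos e)) /
        (Real.pi * e * Real.sinh (Real.pi * e / h))) (𝓝[<] d) (𝓝
      (h * (2 * K / (min α β * Real.cos (Real.pi / 2 * Real.sin d) ^ ((α + β) / 2) * Real.cos d)) /
        (Real.pi * d * Real.sinh (Real.pi * d / h)))) := by
    refine Tendsto.mono_left ?_ nhdsWithin_le_nhds
    have h1 : ContinuousAt (fun e : ℝ => Real.cos (Real.pi / 2 * Real.sin e) ^ ((α + β) / 2)) d :=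
      ContinuousAt.rpow_const (by fun_prop) (Or.inl hCd.ne')
    have h2 : ContinuousAt (fun e : ℝ => Real.sinh (Real.pi * e / h)) d :=
      Real.continuous_sinh.continuousAt.comp (by fun_prop)
    refine ContinuousAt.tendsto (x := d) (f := fun e : ℝ =>
      h * (2 * K / (min α β * Real.cos (Real.pi / 2 * Real.sin e) ^ ((α + β) / 2) * Real.cos e)) /
        (Real.pi * e * Real.sinh (Real.pi * e / h))) ?_
    refine ContinuousAt.div (continuousAt_const.mul (continuousAt_const.div
      ((continuousAt_const.mul h1).mul Real.continuous_cos.continuousAt) ?_))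
      ((continuousAt_const.mul continuousAt_id).mul h2) ?_
    · positivity
    · positivity
  refine ge_of_tendsto hlim ?_
  filter_upwards [Ioo_mem_nhdsLT hd] with e he
  have hce : 0 < Real.cos e := Real.cos_pos_of_mem_Ioo ⟨by linarith [he.1], by linarith [he.2]⟩
  have hCe := cos_pi_div_two_mul_sin_pos (y := e) (by rw [abs_of_pos he.1]; linarith [he.2])
  set q := Real.pi * min α β / 2 * Real.cos e with hq
  have hq0 : 0 < q := by positivity
  set C := K * (Real.pi / 2) / Real.cos (Real.pi / 2 * Real.sin e) ^ ((α + β) / 2) with hC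
  have hC0 : 0 ≤ C := by positivity
  have hF := differentiableOn_comp_deMap hf
  have hbd : ∀ ζ : ℂ, |ζ.im| ≤ e → ‖f (deMap ζ) * deriv deMap ζ‖ ≤
      C * (Real.cosh ζ.re * Real.exp (-(q * |Real.sinh ζ.re|))) := fun ζ hζ =>
    norm_comp_deMap_le_exp_abs he.2 hd' hK hα hβ hbound hζ
  have hN : ∀ R : ℝ, 0 ≤ R → ∀ y : ℝ, |y| = e → ∫ x : ℝ in -R..R,
      ‖f (deMap (x + y * Complex.I)) * deriv deMap (x + y * Complex.I)‖ ≤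
      2 * K / (min α β * Real.cos (Real.pi / 2 * Real.sin e) ^ ((α + β) / 2) * Real.cos e) := by
    intro R hR y hy
    have hval : 2 * K / (min α β * Real.cos (Real.pi / 2 * Real.sin e) ^ ((α + β) / 2) *
        Real.cos e) = C * (2 / q) := by
      have : 0 < Real.cos (Real.pi / 2 * Real.sin e) ^ ((α + β) / 2) := by positivity
      rw [hC, hq]
      field_simp
    rw [hval]
    refine le_trans ?_ (mul_le_mul_of_nonneg_left (integral_cosh_mul_exp_le hq0 hR) hC0)
    rw [← intervalIntegral.integral_const_mul]
    apply intervalIntegral.integral_mono_on (by linarith)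
    · apply Continuous.intervalIntegrable
      rw [← continuousOn_univ]
      refine (hF.continuousOn.comp (f := fun x : ℝ => (x + y * Complex.I : ℂ)) (by fun_prop)
        fun x _ => ?_).norm
      simp only [strip, Set.mem_ofPred_eq]
      simpa [hy] using he.2
    · apply Continuous.intervalIntegrable
      have := Real.continuous_sinh
      have := Real.continuous_cosh
      fun_prop
    · intro x _
      have := hbd (x + y * Complex.I) (by simpa using hy.le)
      simpa using this
  exact norm_improper_integral_error_le hh he.1 he.2 hF
    (B := C * (1 + 1 / q))
    (fun z hz => (hbd z hz).trans (mul_le_mul_of_nonneg_left (cosh_mul_exp_le hq0 _) hC0)) hN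
    (summable_norm_comp_deMap hd hd' hK hα hβ hbound hh)
    (tendsto_integral_comp_deMap hd hf hτ (intervalIntegrable_zero hd hf hK hα hβ hbound hτ))

/-! ### Truncation error -/

/-- All that is kept of the threshold. In the first case the outer square root is at least 1; in the
second, `sinh x ≥ 1` and `πγ ≥ 1`. -/
theorem one_le_mul_sinh_of_xThreshold_le {γ x : ℝ} (hγ : 0 < γ) (hx : xThreshold (γ / 2) ≤ x) :
    1 ≤ Real.pi * γ * Real.sinh x := by
  have hc : 0 < Real.pi * γ := by positivity
  have e : 2 * Real.pi * (γ / 2) = Real.pi * γ := by ring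
  rw [xThreshold, e] at hx
  split_ifs at hx with h1
  · have h2 := Real.sinh_le_sinh.mpr hx
    rw [Real.sinh_arsinh, div_le_iff₀ hc] at h2
    have h3 : 1 ≤ Real.sqrt (1 + Real.sqrt (1 - (Real.pi * γ) ^ 2)) := by
      rw [Real.one_le_sqrt]
      linarith [Real.sqrt_nonneg (1 - (Real.pi * γ) ^ 2)]
    linarith
  · have h2 := Real.sinh_le_sinh.mpr hx
    rw [Real.sinh_arsinh] at h2
    rw [not_lt, div_le_iff₀ (by positivity)] at h1
    nlinarith

/-- Monotonicity up to a factor 2. From `sinh (y - x) ≥ 0` one gets `cosh y / cosh x ≤ t / s`, and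
`2s e^{q(t-s)} ≥ 2s + 2qs (t - s) ≥ s + t ≥ t` because `2qs ≥ 1`. -/
theorem cosh_mul_exp_le_two_mul {q x y : ℝ} (hq : 0 < q) (hx : 1 ≤ 2 * q * Real.sinh x)
    (hxy : x ≤ y) : Real.cosh y * Real.exp (-(q * Real.sinh y)) ≤
      2 * (Real.cosh x * Real.exp (-(q * Real.sinh x))) := by
  set s := Real.sinh x with hs
  set t := Real.sinh y with ht
  have hs0 : 0 < s := by
    by_contra h0
    nlinarith [not_lt.mp h0]
  have h1 : Real.cosh y * s ≤ Real.cosh x * t := by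
    have := Real.sinh_sub y x
    have h2 : 0 ≤ Real.sinh (y - x) := Real.sinh_nonneg_iff.mpr (by linarith)
    rw [this] at h2
    linarith
  have h3 : t ≤ 2 * s * Real.exp (q * (t - s)) := by
    have hst : s ≤ t := Real.sinh_le_sinh.mpr hxy
    have h4 := mul_le_mul_of_nonneg_left (Real.add_one_le_exp (q * (t - s)))
      (show 0 ≤ 2 * s by positivity)
    nlinarith
  have h5 : Real.cosh y * s ≤ 2 * Real.cosh x * Real.exp (q * (t - s)) * s := by
    have := mul_le_mul_of_nonneg_left h3 (Real.cosh_pos x).le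
    linarith
  have h6 := le_of_mul_le_mul_right h5 hs0
  have h7 : Real.exp (-(q * s)) = Real.exp (q * (t - s)) * Real.exp (-(q * t)) := by
    rw [← Real.exp_add]; ring_nf
  rw [h7]
  have := mul_le_mul_of_nonneg_right h6 (Real.exp_pos (-(q * t))).le
  linarith

/-- At a mean value point `ξ` of the antiderivative, `h` times the function is its exact integral
over `[x, x + h]`; passing from `ξ` to `x + h` costs the factor 2. Summed over the grid, the right
side telescopes. -/
theorem mul_cosh_mul_exp_le_sub {q h x : ℝ} (hq : 0 < q) (hh : 0 < h)
    (hx : 1 ≤ 2 * q * Real.sinh x) :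
    h * (Real.cosh (x + h) * Real.exp (-(q * Real.sinh (x + h)))) ≤
      2 / q * (Real.exp (-(q * Real.sinh x)) - Real.exp (-(q * Real.sinh (x + h)))) := by
  obtain ⟨ξ, hξ, hξ'⟩ := exists_hasDerivAt_eq_slope
    (fun x => -(Real.exp (-(q * Real.sinh x)) / q)) _ (show x < x + h by linarith)
    (fun y _ => (hasDerivAt_exp_neg_mul_sinh hq.ne' y).continuousAt.continuousWithinAt)
    (fun y _ => hasDerivAt_exp_neg_mul_sinh hq.ne' y)
  have h1 : 1 ≤ 2 * q * Real.sinh ξ :=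
    hx.trans (mul_le_mul_of_nonneg_left (Real.sinh_le_sinh.mpr hξ.1.le) (by positivity))
  have h2 := mul_le_mul_of_nonneg_left (cosh_mul_exp_le_two_mul hq h1 hξ.2.le) hh.le
  rw [hξ'] at h2
  refine h2.trans (le_of_eq ?_)
  rw [add_sub_cancel_left]
  field_simp
  ring

theorem sum_mul_cosh_mul_exp_le {q h : ℝ} (hq : 0 < q) (hh : 0 < h) {N : ℤ}
    (hN : 1 ≤ 2 * q * Real.sinh (N * h)) (N' : ℤ) :
    ∑ k ∈ Finset.Ioc N N', h * (Real.cosh (k * h) * Real.exp (-(q * Real.sinh (k * h)))) ≤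
      2 / q * Real.exp (-(q * Real.sinh (N * h))) := by
  rcases lt_or_ge N' N with hlt | hge
  · rw [Finset.Ioc_eq_empty (by omega), Finset.sum_empty]
    positivity
  obtain ⟨m, rfl⟩ := Int.le.dest hge
  have key : ∑ k ∈ Finset.Ioc N (N + m),
      h * (Real.cosh (k * h) * Real.exp (-(q * Real.sinh (k * h)))) ≤
      2 / q * (Real.exp (-(q * Real.sinh (N * h))) -
        Real.exp (-(q * Real.sinh (((N + m : ℤ) : ℝ) * h)))) := by
    clear hge
    induction m with
    | zero => simp
    | succ m ih =>
      have h1 : Finset.Ioc N (N + ((m + 1 : ℕ) : ℤ)) =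
          insert (N + (m : ℤ) + 1) (Finset.Ioc N (N + (m : ℤ))) := by
        ext k
        simp only [Finset.mem_insert, Finset.mem_Ioc]
        push_cast
        omega
      have h2 : N + (m : ℤ) + 1 ∉ Finset.Ioc N (N + (m : ℤ)) := by
        simp only [Finset.mem_Ioc]; omega
      have h3 : 1 ≤ 2 * q * Real.sinh (((N + m : ℤ) : ℝ) * h) := by
        refine hN.trans (mul_le_mul_of_nonneg_left (Real.sinh_le_sinh.mpr ?_) (by positivity))
        refine mul_le_mul_of_nonneg_right ?_ hh.le
        push_cast
        linarith [show (0 : ℝ) ≤ m by positivity]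
      have h4 := mul_cosh_mul_exp_le_sub hq hh h3
      have h5 : ((N + (m : ℤ) + 1 : ℤ) : ℝ) * h = ((N + m : ℤ) : ℝ) * h + h := by push_cast; ring
      have h6 : ((N + ((m + 1 : ℕ) : ℤ) : ℤ) : ℝ) * h = ((N + m : ℤ) : ℝ) * h + h := by
        push_cast; ring
      rw [h1, Finset.sum_insert h2, h5, h6]
      linarith
  refine key.trans (mul_le_mul_of_nonneg_left ?_ (by positivity))
  linarith [Real.exp_pos (-(q * Real.sinh (((N + m : ℤ) : ℝ) * h)))]

theorem norm_comp_deMap_ofReal_le {d : ℝ} (hd : 0 < d) (hd' : d < Real.pi / 2) {f : ℂ → ℂ}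
    {K α β : ℝ} (hK : 0 < K) (hα : 0 < α) (hβ : 0 < β)
    (hbound : ∀ z ∈ deMap '' strip d, ‖f z‖ ≤ K * ‖E₂ z α β‖) (x : ℝ) :
    ‖f (deMap x) * deriv deMap x‖ ≤ K * (Real.pi / 2) *
        (Real.cosh x * Real.exp (-(Real.pi * β / 2 * Real.sinh x))) ∧
    ‖f (deMap x) * deriv deMap x‖ ≤ K * (Real.pi / 2) *
        (Real.cosh (-x) * Real.exp (-(Real.pi * α / 2 * Real.sinh (-x)))) := by
  constructor
  · have := norm_comp_deMap_le hd' hK hα hβ hbound (ofReal_mem_strip hd x)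
      (s := Real.pi * β / 2 * Real.sinh x) (Or.inl (by simp; linarith))
    simpa using this
  · have := norm_comp_deMap_le hd' hK hα hβ hbound (ofReal_mem_strip hd x)
      (s := Real.pi * α / 2 * Real.sinh (-x)) (Or.inr (by simp; linarith))
    simpa using this

/-- The truncation error of the double-exponential Sinc indefinite integration. -/
theorem norm_truncation_error_le {d : ℝ} (hd : 0 < d) (hd' : d < Real.pi / 2) {f : ℂ → ℂ}
    {K α β : ℝ} (hK : 0 < K) (hα : 0 < α) (hβ : 0 < β)
    (hbound : ∀ z ∈ deMap '' strip d, ‖f z‖ ≤ K * ‖E₂ z α β‖) {h : ℝ} (hh : 0 < h)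
    {M N : ℤ} (hM : xThreshold (α / 2) ≤ M * h) (hN : xThreshold (β / 2) ≤ N * h) (X : ℝ) :
    ‖(∑' k : ℤ, f (deMap ((k * h : ℝ) : ℂ)) * deriv deMap ((k * h : ℝ) : ℂ) * (J k h X : ℂ)) -
        ∑ k ∈ Finset.Icc (-M) N,
          f (deMap ((k * h : ℝ) : ℂ)) * deriv deMap ((k * h : ℝ) : ℂ) * (J k h X : ℂ)‖ ≤
      3 * K / β * Real.exp (-(Real.pi * β / 2 * Real.sinh (N * h))) +
        3 * K / α * Real.exp (-(Real.pi * α / 2 * Real.sinh (M * h))) := by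
  set u : ℤ → ℂ := fun k =>
    f (deMap ((k * h : ℝ) : ℂ)) * deriv deMap ((k * h : ℝ) : ℂ) * (J k h X : ℂ) with hu
  have huF : ∀ k, ‖u k‖ ≤
      ‖f (deMap ((k * h : ℝ) : ℂ)) * deriv deMap ((k * h : ℝ) : ℂ)‖ * (3 / 2 * h) := fun k => by
    rw [hu]
    simp only
    rw [norm_mul _ (J k h X : ℂ), Complex.norm_real]
    exact mul_le_mul_of_nonneg_left (abs_J_le k hh X) (norm_nonneg _)
  have hsum : Summable u := Summable.of_norm_bounded
    ((summable_norm_comp_deMap hd hd' hK hα hβ hbound hh).mul_right _) huF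
  have hpos : ∀ {γ : ℝ} {m : ℤ}, 0 < γ → xThreshold (γ / 2) ≤ m * h →
      1 ≤ 2 * (Real.pi * γ / 2) * Real.sinh (m * h) := fun hγ hm => by
    have := one_le_mul_sinh_of_xThreshold_le hγ hm
    rwa [show ∀ γ : ℝ, 2 * (Real.pi * γ / 2) = Real.pi * γ from fun γ => by ring]
  have huN : ∀ k, ‖u k‖ ≤ 3 / 2 * (K * (Real.pi / 2)) *
      (h * (Real.cosh (k * h) * Real.exp (-(Real.pi * β / 2 * Real.sinh (k * h))))) := fun k => by
    refine (huF k).trans ?_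
    have := mul_le_mul_of_nonneg_right
      (norm_comp_deMap_ofReal_le hd hd' hK hα hβ hbound (k * h)).1 (show 0 ≤ 3 / 2 * h by positivity)
    linarith
  have huM : ∀ k, ‖u k‖ ≤ 3 / 2 * (K * (Real.pi / 2)) * (h * (Real.cosh (((-k : ℤ) : ℝ) * h) *
      Real.exp (-(Real.pi * α / 2 * Real.sinh (((-k : ℤ) : ℝ) * h))))) := fun k => by
    refine (huF k).trans ?_
    have := mul_le_mul_of_nonneg_right
      (norm_comp_deMap_ofReal_le hd hd' hK hα hβ hbound (k * h)).2 (show 0 ≤ 3 / 2 * h by positivity)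
    rw [show ((-k : ℤ) : ℝ) * h = -(k * h) by push_cast; ring]
    linarith
  -- The bound is shown for the symmetric partial sums with `n ≥ |M|, |N|`, where it concerns two
  -- finite tails, and passes to the limit.
  refine le_of_tendsto ((tendsto_sum_Icc_neg hsum).sub_const _).norm ?_
  filter_upwards [eventually_ge_atTop (max M.natAbs N.natAbs)] with n hn
  have hMn : M ≤ n := by have := le_of_max_le_left hn; omega
  have hNn : N ≤ n := by have := le_of_max_le_right hn; omega
  rw [← Finset.sum_sdiff (Finset.Icc_subset_Icc (neg_le_neg hMn) hNn), add_sub_cancel_right]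
  have hsub : Finset.Icc (-(n : ℤ)) n \ Finset.Icc (-M) N ⊆
      Finset.Ioc N n ∪ Finset.Ico (-(n : ℤ)) (-M) := by
    intro k
    simp only [Finset.mem_sdiff, Finset.mem_Icc, Finset.mem_union, Finset.mem_Ioc, Finset.mem_Ico]
    omega
  have hreindex : ∑ k ∈ Finset.Ico (-(n : ℤ)) (-M), (h * (Real.cosh (((-k : ℤ) : ℝ) * h) *
      Real.exp (-(Real.pi * α / 2 * Real.sinh (((-k : ℤ) : ℝ) * h))))) =
      ∑ k ∈ Finset.Ioc M n, h * (Real.cosh (k * h) *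
        Real.exp (-(Real.pi * α / 2 * Real.sinh (k * h)))) := by
    refine Finset.sum_nbij' (fun k => -k) (fun k => -k) ?_ ?_ ?_ ?_ ?_ <;>
      intro k hk <;> simp only [Finset.mem_Ico, Finset.mem_Ioc, neg_neg] at hk ⊢ <;> omega
  have hSN := mul_le_mul_of_nonneg_left
    (sum_mul_cosh_mul_exp_le (q := Real.pi * β / 2) (by positivity) hh (hpos hβ hN) n)
    (show 0 ≤ 3 / 2 * (K * (Real.pi / 2)) by positivity)
  have hSM := mul_le_mul_of_nonneg_left
    (sum_mul_cosh_mul_exp_le (q := Real.pi * α / 2) (by positivity) hh (hpos hα hM) n)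
    (show 0 ≤ 3 / 2 * (K * (Real.pi / 2)) by positivity)
  rw [← hreindex] at hSM
  have hval : ∀ γ : ℝ, 0 < γ → ∀ E : ℝ,
      3 / 2 * (K * (Real.pi / 2)) * (2 / (Real.pi * γ / 2) * E) = 3 * K / γ * E := by
    intro γ hγ E
    field_simp
  rw [hval _ hβ] at hSN
  rw [hval _ hα] at hSM
  rw [Finset.mul_sum] at hSN hSM
  calc ‖∑ k ∈ Finset.Icc (-(n : ℤ)) n \ Finset.Icc (-M) N, u k‖
      ≤ ∑ k ∈ Finset.Icc (-(n : ℤ)) n \ Finset.Icc (-M) N, ‖u k‖ := norm_sum_le _ _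
    _ ≤ ∑ k ∈ Finset.Ioc N n ∪ Finset.Ico (-(n : ℤ)) (-M), ‖u k‖ :=
        Finset.sum_le_sum_of_subset_of_nonneg hsub fun _ _ _ => norm_nonneg _
    _ ≤ ∑ k ∈ Finset.Ioc N n, ‖u k‖ + ∑ k ∈ Finset.Ico (-(n : ℤ)) (-M), ‖u k‖ := by
        rw [← Finset.sum_union_inter]
        exact le_add_of_nonneg_right (Finset.sum_nonneg fun _ _ => norm_nonneg _)
    _ ≤ _ := add_le_add ((Finset.sum_le_sum fun k _ => huN k).trans hSN)
        ((Finset.sum_le_sum fun k _ => huM k).trans hSM)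

/-! ### Reduction to the stated constants -/

/-- For `L ≤ 2`, `e^{1-L} ≥ 2 - L` and `e ≥ 2` reduce it to `(L - 1)(L - 3) ≤ 0`. For `L ≥ 2` the
term `e (L - 1)` suffices. -/
theorem one_le_exp_one_mul {L : ℝ} (hL : 1 ≤ L) :
    1 ≤ Real.exp 1 * (L - 1 + L * Real.exp (-L)) := by
  have he : 2 ≤ Real.exp 1 := by linarith [Real.add_one_le_exp 1]
  have h1 : 2 - L ≤ Real.exp 1 * Real.exp (-L) := by
    rw [← Real.exp_add]
    linarith [Real.add_one_le_exp (1 + -L)]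
  have h0 : 0 ≤ Real.exp 1 * Real.exp (-L) := by positivity
  rcases le_total L 2 with h2 | h2
  · have h3 : 2 * (L - 1) ≤ Real.exp 1 * (L - 1) :=
      mul_le_mul_of_nonneg_right he (by linarith)
    have h4 := mul_le_mul_of_nonneg_left h1 (by linarith : 0 ≤ L)
    nlinarith
  · have h3 : Real.exp 1 * 1 ≤ Real.exp 1 * (L - 1) :=
      mul_le_mul_of_nonneg_left (by linarith) (by positivity)
    have h4 := mul_nonneg (by linarith : 0 ≤ L) h0
    linarith

/-- Used with `q = dn`. It amounts to `3q ≤ L e^t`, where `t = πq - πq/L + πμ/4`. Now `e^t ≥ e · t`,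
and `μ/4 = q e^{-L}` turns `L t` into `πq (L - 1 + L e^{-L})`, so `one_le_exp_one_mul` and `π > 3`
finish. At `L = 1` the first two terms of `t` cancel, and only `πμ/4` is left. -/
theorem three_mul_exp_neg_le {μ L : ℝ} (hμ : 0 < μ) (hL : 1 ≤ L) {q : ℝ}
    (hq : q = μ * Real.exp L / 4) :
    3 * q * Real.exp (-(Real.pi * q)) ≤
      Real.exp (Real.pi * μ / 4) * (Real.exp (-(Real.pi * q / L)) * L) := by
  have hL0 : 0 < L := by linarith
  have hq0 : 0 < q := by rw [hq]; positivity
  have hμq : μ / 4 = q * Real.exp (-L) := by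
    rw [hq, Real.exp_neg]; field_simp
  set t := Real.pi * q - Real.pi * q / L + Real.pi * μ / 4 with ht
  have h1 : Real.exp 1 * t ≤ Real.exp t := by
    have h2 := Real.add_one_le_exp (t - 1)
    have h3 : Real.exp t = Real.exp 1 * Real.exp (t - 1) := by rw [← Real.exp_add]; ring_nf
    rw [h3]
    exact mul_le_mul_of_nonneg_left (by linarith) (Real.exp_pos _).le
  have h2 : L * t = Real.pi * q * (L - 1 + L * Real.exp (-L)) := by
    have : Real.pi * μ / 4 = Real.pi * (q * Real.exp (-L)) := by rw [← hμq]; ring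
    rw [ht, this]
    field_simp
  have h3 : 3 * q ≤ L * Real.exp t := by
    calc 3 * q ≤ Real.pi * q * 1 := by nlinarith [Real.pi_gt_three]
      _ ≤ Real.pi * q * (Real.exp 1 * (L - 1 + L * Real.exp (-L))) :=
          mul_le_mul_of_nonneg_left (one_le_exp_one_mul hL) (by positivity)
      _ = L * (Real.exp 1 * t) := by linear_combination -Real.exp 1 * h2
      _ ≤ L * Real.exp t := mul_le_mul_of_nonneg_left h1 hL0.le
  have h4 : Real.exp (Real.pi * μ / 4) * (Real.exp (-(Real.pi * q / L)) * L) =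
      L * Real.exp t * Real.exp (-(Real.pi * q)) := by
    rw [ht, mul_assoc L, ← Real.exp_add, ← mul_assoc, ← Real.exp_add]
    ring_nf
  rw [h4]
  exact mul_le_mul_of_nonneg_right h3 (Real.exp_pos _).le

/-- Uses `sinh x ≥ (e^x - 1) / 2`; the lost `1/2` is the origin of the factor `e^{πγ/4}`. -/
theorem exp_neg_mul_sinh_le {γ x y : ℝ} (hγ : 0 < γ) (hx : 0 ≤ x)
    (hxy : 4 * y / γ ≤ Real.exp x) :
    Real.exp (-(Real.pi * γ / 2 * Real.sinh x)) ≤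
      Real.exp (Real.pi * γ / 4) * Real.exp (-(Real.pi * y)) := by
  rw [← Real.exp_add]
  apply Real.exp_le_exp.mpr
  have h1 : Real.exp (-x) ≤ 1 := Real.exp_le_one_iff.mpr (by linarith)
  rw [div_le_iff₀ hγ] at hxy
  have h2 : 4 * y - γ ≤ 2 * (γ * Real.sinh x) := by
    rw [Real.sinh_eq]
    nlinarith
  have h3 := mul_le_mul_of_nonneg_left h2 (show 0 ≤ Real.pi / 4 by positivity)
  linarith

/-- Subtracting a floor rounds the truncation number upwards, so no decay is lost. -/
theorem floor_trunc {n : ℕ} {h m r : ℝ} (hh : 0 < h) (hm : 0 < m) (hr : 0 < r)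
    (hnh : n * h = Real.log m) :
    m / r ≤ Real.exp (((n - ⌊Real.log r / h⌋ : ℤ) : ℝ) * h) := by
  have h1 : m / r = Real.exp (Real.log m - Real.log r) := by
    rw [Real.exp_sub, Real.exp_log hm, Real.exp_log hr]
  rw [h1]
  apply Real.exp_le_exp.mpr
  have h2 := (le_div_iff₀ hh).mp (Int.floor_le (Real.log r / h))
  push_cast
  linarith

theorem trunc_lower_bounds {α β μ d : ℝ} (hα : 0 < α) (hβ : 0 < β) (hμ : μ = min α β)
    (hd : 0 < d) {n : ℕ} (hn : 0 < n) {h : ℝ} (hh : 0 < h)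
    (hnh : n * h = Real.log (4 * d * n / μ)) :
    4 * (d * n) / α ≤ Real.exp (truncM α β h n * h) ∧
      4 * (d * n) / β ≤ Real.exp (truncN α β h n * h) := by
  have hn' : (0 : ℝ) < n := by exact_mod_cast hn
  have hμ0 : 0 < μ := by rw [hμ]; exact lt_min hα hβ
  have hm : 0 < 4 * d * n / μ := by positivity
  rw [truncM, truncN]
  split_ifs with hab
  · rw [min_eq_left hab] at hμ
    subst hμ
    refine ⟨?_, ?_⟩
    · rw [Int.cast_natCast, hnh, Real.exp_log hm, mul_assoc]
    · refine le_trans (le_of_eq ?_) (floor_trunc hh hm (div_pos hβ hα) hnh)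
      field_simp
  · rw [min_eq_right (not_le.mp hab).le] at hμ
    subst hμ
    refine ⟨?_, ?_⟩
    · refine le_trans (le_of_eq ?_) (floor_trunc hh hm (div_pos hα hβ) hnh)
      field_simp
    · rw [Int.cast_natCast, hnh, Real.exp_log hm, mul_assoc]

theorem truncation_const_le {K α β μ d L : ℝ} (hK : 0 < K) (hα : 0 < α) (hβ : 0 < β)
    (hμ : μ = min α β) (hd : 0 < d) {n : ℕ} (hn : 0 < n) (hL : L = Real.log (4 * d * n / μ))
    (hL1 : 1 ≤ L) :
    3 * K / β * (Real.exp (Real.pi * β / 4) * Real.exp (-(Real.pi * (d * n)))) +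
        3 * K / α * (Real.exp (Real.pi * α / 4) * Real.exp (-(Real.pi * (d * n)))) ≤
      2 * K / (μ * d) * Real.exp (Real.pi * (α + β) / 4) *
        (Real.exp (-(Real.pi * d * n / L)) * L / n) := by
  have hn' : (0 : ℝ) < n := by exact_mod_cast hn
  have hμ0 : 0 < μ := by rw [hμ]; exact lt_min hα hβ
  have hq : d * n = μ * Real.exp L / 4 := by
    rw [hL, Real.exp_log (by positivity)]
    field_simp
  have key := three_mul_exp_neg_le hμ0 hL1 hq
  have hterm : ∀ γ, μ ≤ γ → γ ≤ max α β →
      3 * K / γ * (Real.exp (Real.pi * γ / 4) * Real.exp (-(Real.pi * (d * n)))) ≤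
      3 * K / μ * (Real.exp (Real.pi * max α β / 4) * Real.exp (-(Real.pi * (d * n)))) := by
    intro γ h1 h2
    have : Real.exp (Real.pi * γ / 4) ≤ Real.exp (Real.pi * max α β / 4) := by
      apply Real.exp_le_exp.mpr
      have := mul_le_mul_of_nonneg_left h2 Real.pi_pos.le
      linarith
    gcongr
  -- The factor with `max α β` bounds both tails; the one with `μ` is spent in
  -- `three_mul_exp_neg_le`.
  have hsplit : Real.exp (Real.pi * (α + β) / 4) =
      Real.exp (Real.pi * max α β / 4) * Real.exp (Real.pi * μ / 4) := by
    rw [← Real.exp_add, hμ]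
    congr 1
    linear_combination -(Real.pi / 4) * min_add_max α β
  have hA := hterm α (hμ.le.trans (min_le_left _ _)) (le_max_left _ _)
  have hB := hterm β (hμ.le.trans (min_le_right _ _)) (le_max_right _ _)
  refine (add_le_add hB hA).trans ?_
  rw [hsplit]
  have h2 := mul_le_mul_of_nonneg_left key
    (show 0 ≤ 2 * K / (μ * d * n) * Real.exp (Real.pi * max α β / 4) by positivity)
  refine le_trans (le_of_eq ?_) (h2.trans (le_of_eq ?_))
  · field_simp
    ring
  · rw [mul_assoc Real.pi d]
    field_simp

theorem discretization_const_le {K μ d h C c : ℝ} (hK : 0 < K) (hμ : 0 < μ) (hd : 0 < d)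
    (hh : 0 < h) (hC : 0 < C) (hc : 0 < c) (hhμ : h * (μ * Real.exp 1) ≤ 4 * d) :
    h * (2 * K / (μ * C * c)) / (Real.pi * d * Real.sinh (Real.pi * d / h)) ≤
      2 * K / (μ * d) * (1 / ((1 - Real.exp (-(Real.pi * μ * Real.exp 1 / 2))) * C * c)) *
        (Real.exp (-(Real.pi * d / h)) * h) := by
  set t := Real.pi * d / h with ht
  have ht0 : 0 < t := by positivity
  set E := Real.exp (-(Real.pi * μ * Real.exp 1 / 2)) with hE
  have hE1 : 0 < 1 - E := by
    rw [hE, sub_pos, Real.exp_lt_one_iff]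
    have : 0 < Real.pi * μ * Real.exp 1 / 2 := by positivity
    linarith
  have h2t : Real.pi * μ * Real.exp 1 / 2 ≤ 2 * t := by
    rw [ht, mul_div_assoc', le_div_iff₀ hh]
    have := mul_le_mul_of_nonneg_left hhμ (show 0 ≤ Real.pi / 2 by positivity)
    linarith
  have hsinh : Real.exp t * (1 - E) / 2 ≤ Real.sinh t := by
    have h1 : Real.exp (-(2 * t)) ≤ E := Real.exp_le_exp.mpr (by linarith)
    have h3 : Real.exp (-t) = Real.exp t * Real.exp (-(2 * t)) := by
      rw [← Real.exp_add]; ring_nf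
    rw [Real.sinh_eq, h3]
    have := mul_le_mul_of_nonneg_left h1 (Real.exp_pos t).le
    linarith
  have hden : Real.exp t * (1 - E) * d ≤ Real.pi * d * Real.sinh t := by
    have h1 : Real.pi * d * (Real.exp t * (1 - E) / 2) ≤ Real.pi * d * Real.sinh t :=
      mul_le_mul_of_nonneg_left hsinh (by positivity)
    -- The factor `π/2 ≥ 1` is given away here, as the stated constant contains no `π` in this
    -- place.
    have h2 : 0 ≤ (Real.pi / 2 - 1) * (Real.exp t * (1 - E) * d) :=
      mul_nonneg (by linarith [Real.pi_gt_three]) (by positivity)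
    linarith
  refine (div_le_div_of_nonneg_left (by positivity) (by positivity) hden).trans (le_of_eq ?_)
  rw [Real.exp_neg]
  field_simp

end SincDE

/-! ### Assembly of the error bound -/

theorem theorem3p5
    (d : ℝ) (hd : 0 < d) (hd' : d < Real.pi / 2)
    (f : ℂ → ℂ) (hf : AnalyticOnNhd ℂ f (SincDE.deMap '' SincDE.strip d))
    (K α β : ℝ) (hK : 0 < K) (hα : 0 < α) (hβ : 0 < β)
    (hbound : ∀ z ∈ SincDE.deMap '' SincDE.strip d, ‖f z‖ ≤ K * ‖SincDE.E₂ z α β‖)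
    (μ ν : ℝ) (hμ : μ = min α β) (hν : ν = max α β)
    (n : ℕ) (h : ℝ) (hh : h = Real.log (4 * d * n / μ) / n)
    (M N : ℤ) (hM : M = SincDE.truncM α β h n) (hN : N = SincDE.truncN α β h n)
    (hn : ν * Real.exp 1 / (4 * d) ≤ n)
    (hMh : SincDE.xThreshold (α / 2) ≤ M * h)
    (hNh : SincDE.xThreshold (β / 2) ≤ N * h) :
    ∀ τ : ℝ, 0 < τ →
      IntervalIntegrable (fun t : ℝ => f t) MeasureTheory.volume 0 τ ∧
      ‖(∫ t in (0 : ℝ)..τ, f t) -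
          ∑ k ∈ Finset.Icc (-M) N,
            f (SincDE.deMap ((k * h : ℝ) : ℂ)) * deriv SincDE.deMap ((k * h : ℝ) : ℂ) *
              (SincDE.J k h (SincDE.deInv τ) : ℂ)‖
        ≤ SincDE.constC₂ K α β d μ * SincDE.epsDE d μ n := by
  intro τ hτ
  refine ⟨SincDE.intervalIntegrable_zero hd hf hK hα hβ hbound hτ, ?_⟩
  have hμ0 : 0 < μ := by rw [hμ]; exact lt_min hα hβ
  have hμν : μ ≤ ν := by rw [hμ, hν]; exact min_le_max
  have hn0 : (0 : ℝ) < n := lt_of_lt_of_le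
    (by have : 0 < ν := hμ0.trans_le hμν
        positivity) hn
  have hnN : 0 < n := by exact_mod_cast hn0
  set m := 4 * d * n / μ with hm
  have hm0 : 0 < m := by positivity
  have hem : Real.exp 1 ≤ m := by
    rw [hm, le_div_iff₀ hμ0]
    rw [div_le_iff₀ (by positivity)] at hn
    have := mul_le_mul_of_nonneg_right hμν (Real.exp_pos 1).le
    linarith
  have hL1 : 1 ≤ Real.log m := by rwa [Real.le_log_iff_exp_le hm0]
  have hh0 : 0 < h := by rw [hh]; positivity
  have hnh : n * h = Real.log m := by rw [hh]; field_simp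
  -- From `log m ≤ m / e`. It bounds `πd/h` below independently of `n`, whence the constant `1 -
  -- e^{-πμe/2}`.
  have hhμ : h * (μ * Real.exp 1) ≤ 4 * d := by
    have h1 : Real.log m * Real.exp 1 ≤ m := by
      have h2 := Real.add_one_le_exp (Real.log m - 1)
      rw [Real.exp_sub, Real.exp_log hm0, sub_add_cancel, le_div_iff₀ (Real.exp_pos _)] at h2
      exact h2
    have h3 := mul_le_mul_of_nonneg_left h1 (show 0 ≤ μ / n by positivity)
    have h4 : μ / n * m = 4 * d := by rw [hm]; field_simp
    rw [h4] at h3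
    refine le_trans (le_of_eq ?_) h3
    rw [hh]
    ring
  have hpos : ∀ {γ x : ℝ}, 0 < γ → SincDE.xThreshold (γ / 2) ≤ x → 0 ≤ x := fun hγ hx => by
    have h1 := SincDE.one_le_mul_sinh_of_xThreshold_le hγ hx
    rw [← Real.sinh_nonneg_iff]
    by_contra h2
    have := mul_pos Real.pi_pos hγ
    nlinarith [not_le.mp h2]
  obtain ⟨hlM, hlN⟩ := SincDE.trunc_lower_bounds hα hβ hμ hd hnN hh0 hnh
  rw [← hM] at hlM
  rw [← hN] at hlN
  have hdisc := SincDE.norm_discretization_error_le hd hd' hf hK hα hβ hbound hh0 hτ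
  have htrunc := SincDE.norm_truncation_error_le hd hd' hK hα hβ hbound hh0 hMh hNh
    (SincDE.deInv τ)
  have hCd := SincDE.cos_pi_div_two_mul_sin_pos (y := d) (by rwa [abs_of_pos hd])
  have hcd : 0 < Real.cos d := Real.cos_pos_of_mem_Ioo ⟨by linarith, hd'⟩
  rw [← hμ] at hdisc
  have hdc := SincDE.discretization_const_le hK hμ0 hd hh0
    (Real.rpow_pos_of_pos hCd ((α + β) / 2)) hcd hhμ
  have htc := SincDE.truncation_const_le hK hα hβ hμ hd hnN rfl hL1
  rw [← hm] at htc
  have htd : Real.pi * d / h = Real.pi * d * n / Real.log m := by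
    rw [hh]
    field_simp
  rw [htd] at hdc
  have hsN := mul_le_mul_of_nonneg_left
    (SincDE.exp_neg_mul_sinh_le hβ (hpos hβ hNh) hlN) (show 0 ≤ 3 * K / β by positivity)
  have hsM := mul_le_mul_of_nonneg_left
    (SincDE.exp_neg_mul_sinh_le hα (hpos hα hMh) hlM) (show 0 ≤ 3 * K / α by positivity)
  have heps : Real.exp (-(Real.pi * d * n / Real.log m)) * h = SincDE.epsDE d μ n := by
    rw [SincDE.epsDE, ← hm, hh, mul_div_assoc, mul_div_assoc]
  have heps' : Real.exp (-(Real.pi * d * n / Real.log m)) * Real.log m / n =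
      SincDE.epsDE d μ n := rfl
  rw [heps, ← htd] at hdc
  rw [heps'] at htc
  -- Triangle inequality through the full series over `ℤ`.
  refine (norm_sub_le_norm_sub_add_norm_sub _ _ _).trans
    ((add_le_add (hdisc.trans hdc)
      (htrunc.trans ((add_le_add hsN hsM).trans htc))).trans (le_of_eq ?_))
  rw [SincDE.constC₂]
  ring
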